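/- Let $(R,\mathfrak m,k)$ be a commutative Noetherian local ring. An $R$-module $N$ is called Gorenstein injective if there is an exact complex $J=\cdots\to J_1\to J_0\to J_{-1}\to\cdots$ of injective $R$-modules such that $\operatorname{Hom}_R(E,J)$ is exact for every injective $R$-module $E$ and $N\cong\operatorname{im}(J_1\to J_0)$. The width of an $R$-module $M$ is $\operatorname{width}_R M=\inf\{n\ge 0 : \operatorname{Tor}^R_n(k,M)\neq 0\}$, with $\inf\emptyset=\infty$. The ring $R$ is Cohen–Macaulay if $\operatorname{depth} R=\dim R$, where $\operatorname{depth} R=\inf\{n\ge 0:\operatorname{Ext}_R^n(k,R)\neq 0\}$. Let $s\ge 0$ be an integer and let $$I=0\to I_0\to I_{-1}\to\cdots\to I_{-s}\to 0$$ be a complex of Gorenstein injective $R$-modules which is not exact and all of whose homology modules are finitely generated. Assume that at least one of the following holds: (i) there is an $R$-module $B$ such that $\operatorname{width}_R B<\infty$ and $\operatorname{width}_R(\operatorname{Hom}_R(B,N))\ge\dim R$ for every Gorenstein injective $R$-module $N$; (ii) $R$ is Cohen–Macaulay. Then $\dim R\le s$. -/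

import Mathlib

open CategoryTheory CategoryTheory.Limits

universe u

noncomputable section

/-- A module `N` is Gorenstein injective if there is an exact complex `J` of injective modules,
indexed by `ℤ` with differentials lowering the degree, such that `Hom_R(E, J)` is exact for every
injective module `E` and `N ≅ im (J₁ ⟶ J₀)`. -/
def IsGorensteinInjective {R : Type u} [CommRing R] (N : ModuleCat.{u} R) : Prop :=
  ∃ J : ChainComplex (ModuleCat.{u} R) ℤ,
    (∀ i : ℤ, Injective (J.X i)) ∧
    J.Acyclic ∧
    (∀ E : ModuleCat.{u} R, Injective E →
      ((((linearCoyoneda R (ModuleCat.{u} R)).obj (Opposite.op E)).mapHomologicalComplex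
        (ComplexShape.down ℤ)).obj J).Acyclic) ∧
    Nonempty (N ≅ image (J.d 1 0))

/-- The width of a module `M` over a local ring `R` with residue field `k`, that is
`inf (k ⊗ᴸ M) = inf {n | Tor_n(k, M) ≠ 0}`, with `inf ∅ = ∞`. -/
def moduleWidth {R : Type u} [CommRing R] [IsLocalRing R] (M : ModuleCat.{u} R) : ℕ∞ :=
  ⨅ (n : ℕ) (_ : ¬ IsZero (((Tor (ModuleCat.{u} R) n).obj
    (ModuleCat.of R (IsLocalRing.ResidueField R))).obj M)), (n : ℕ∞)

/-- The depth of a module `M` over a local ring `R` with residue field `k`, that is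
`- sup RHom(k, M) = inf {n | Ext^n(k, M) ≠ 0}`, with `inf ∅ = ∞`. -/
def moduleDepth {R : Type u} [CommRing R] [IsLocalRing R] (M : ModuleCat.{u} R) : ℕ∞ :=
  ⨅ (n : ℕ) (_ : Nontrivial
    (Abelian.Ext (ModuleCat.of R (IsLocalRing.ResidueField R)) M n)), (n : ℕ∞)

/-- A (Noetherian) local ring is Cohen–Macaulay if its depth equals its Krull dimension. -/
def IsCohenMacaulayLocalRing (R : Type u) [CommRing R] [IsLocalRing R] : Prop :=
  ((moduleDepth (ModuleCat.of R R) : ℕ∞) : WithBot ℕ∞) = ringKrullDim R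

end

/-! Fix `d ≤ dim R` and a module `B` of finite width such that Hom(B, N) has width at least `d` for
every Gorenstein injective `N`. If R is Cohen–Macaulay, `B = R` works: Tor_n(k, J) is Hom(Ext^n(k,
R), J) for J injective, so injective modules have width at least depth R, and left resolutions by
injectives carry this over to Gorenstein injective modules (`IsGorensteinInjective.widthGE`).

Complete the complex along generators of the maximal ideal m by iterated cones of X - x on power
series, and let T be an injective resolution of the result. The cones consist of countable powers,
so the terms stay Gorenstein injective. Finitely generated homology H becomes its zeroth derived
completion, which maps onto H/mH and so is nonzero when H is. Thus T is derived complete and not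
exact, and its cocycles past the end of the complex are Gorenstein injective.

Suppose d > s. Far to the right the cocycles Z of Hom(B, T) have width at least d. If the cocycles
in some degree have positive width, they equal m times themselves, and so does the cohomology there;
this cohomology is derived complete, so Nakayama (`subsingleton_of_derivedComplete`) kills it. The
cocycles one degree to the left are then the kernel of a surjection onto Z, which costs at most one
unit of width. Only s + 1 degrees have to be crossed, and further left T has no cohomology, so
Hom(B, T) is exact.

Hence RHom(k ⊗ᴸ B, T) = RHom(k, RHom(B, T)) = 0. As k ⊗ᴸ B is a nonzero sum of shifts of k, RHom(k,
T) = 0 (`homVanishes_residueField`, by syzygies instead of derived categories). Dévissage and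
Nakayama then give RHom(A, T) = 0 for every finite A (`homVanishes_of_residueField`). The case A = R
says that T is exact, a contradiction. `le_of_widthGE` assembles this. -/

/-! ### Factoring linear maps -/

section Factoring

variable {R : Type u} [CommRing R]

lemma exists_comp_eq_of_mem_range {A B E : Type*} [AddCommGroup A] [Module R A] [AddCommGroup B]
    [Module R B] [AddCommGroup E] [Module R E] {f : A →ₗ[R] B} (hf : Function.Injective f)
    (w : E →ₗ[R] B) (hw : ∀ x, w x ∈ LinearMap.range f) : ∃ v : E →ₗ[R] A, f ∘ₗ v = w := by
  refine ⟨(LinearEquiv.ofInjective f hf).symm.toLinearMap ∘ₗ w.codRestrict _ hw,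
    LinearMap.ext fun x => ?_⟩
  have := (LinearEquiv.ofInjective f hf).apply_symm_apply ⟨w x, hw x⟩
  exact congrArg Subtype.val this

lemma exists_comp_eq_of_ker_le {A B E : Type*} [AddCommGroup A] [Module R A] [AddCommGroup B]
    [Module R B] [AddCommGroup E] [Module R E] {p : A →ₗ[R] B} (hp : Function.Surjective p)
    (q : A →ₗ[R] E) (hk : ∀ x, p x = 0 → q x = 0) : ∃ b : B →ₗ[R] E, b ∘ₗ p = q := by
  refine ⟨(LinearMap.ker p).liftQ q hk ∘ₗ
    (p.quotKerEquivOfSurjective hp).symm.toLinearMap, LinearMap.ext fun y => ?_⟩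
  have : (p.quotKerEquivOfSurjective hp).symm (p y) = Submodule.Quotient.mk y := by
    rw [LinearEquiv.symm_apply_eq]; rfl
  rw [LinearMap.comp_apply, LinearMap.comp_apply, LinearEquiv.coe_coe, this]
  rfl

/-- A map to an injective module extends along `g` as soon as it vanishes on the kernel of `g`. -/
lemma Module.Injective.exists_comp_eq {M N Q : Type u} [AddCommGroup M] [Module R M]
    [AddCommGroup N] [Module R N] [AddCommGroup Q] [Module R Q] (hQ : Module.Injective R Q)
    (g : M →ₗ[R] N) (f : M →ₗ[R] Q) (h : ∀ x, g x = 0 → f x = 0) :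
    ∃ s : N →ₗ[R] Q, s ∘ₗ g = f := by
  obtain ⟨b, hb⟩ := exists_comp_eq_of_ker_le (p := g.rangeRestrict) g.surjective_rangeRestrict f
    (fun x hx => h x (congrArg Subtype.val hx))
  obtain ⟨s, hs⟩ := Module.Injective.extension_property R _ _ _ (LinearMap.range g).subtype
    (Submodule.subtype_injective _) b
  exact ⟨s, by rw [← hb, ← hs]; rfl⟩

end Factoring

/-! ### Gorenstein injective modules: short exact sequences, products, extensions -/

section GorensteinInjective

variable {R : Type u} [CommRing R]

/-- A short exact sequence `0 → K → J → N → 0` with `J` injective that stays exact under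
`Hom(E, -)` for every injective module `E`. -/
structure IsInjectiveSES {K J N : Type u} [AddCommGroup K] [Module R K] [AddCommGroup J]
    [Module R J] [AddCommGroup N] [Module R N] (f : K →ₗ[R] J) (g : J →ₗ[R] N) : Prop where
  injective_mid : Module.Injective R J
  f_injective : Function.Injective f
  g_surjective : Function.Surjective g
  exact : Function.Exact f g
  lift : ∀ (E : ModuleCat.{u} R), Module.Injective R E → ∀ w : E →ₗ[R] N,
    ∃ v : E →ₗ[R] J, g ∘ₗ v = w

lemma acyclic_iff_forall (J : ChainComplex (ModuleCat.{u} R) ℤ) :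
    J.Acyclic ↔ ∀ (i : ℤ) (x : J.X (i + 1)), J.d (i + 1) i x = 0 →
      ∃ y : J.X (i + 1 + 1), J.d (i + 1 + 1) (i + 1) y = x := by
  have key : ∀ i : ℤ, J.ExactAt (i + 1) ↔ ∀ (x : J.X (i + 1)), J.d (i + 1) i x = 0 →
      ∃ y : J.X (i + 1 + 1), J.d (i + 1 + 1) (i + 1) y = x := fun i => by
    rw [J.exactAt_iff' (i + 1 + 1) (i + 1) i (by simp) (by simp),
      ShortComplex.moduleCat_exact_iff]
    rfl
  refine ⟨fun h i => (key i).1 (h _), fun h i => ?_⟩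
  obtain ⟨j, rfl⟩ : ∃ j : ℤ, i = j + 1 := ⟨i - 1, by ring⟩
  exact (key j).2 (h j)

lemma linearCoyoneda_acyclic_iff (E : ModuleCat.{u} R) (J : ChainComplex (ModuleCat.{u} R) ℤ) :
    ((((linearCoyoneda R (ModuleCat.{u} R)).obj (Opposite.op E)).mapHomologicalComplex
        (ComplexShape.down ℤ)).obj J).Acyclic ↔
      ∀ (i : ℤ) (x : E ⟶ J.X (i + 1)), x ≫ J.d (i + 1) i = 0 →
      ∃ y : E ⟶ J.X (i + 1 + 1), y ≫ J.d (i + 1 + 1) (i + 1) = x := by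
  rw [acyclic_iff_forall]
  rfl

/-- An exact complex is cut into short exact sequences at its syzygies; exactness of Hom(E, J)
becomes the lifting of maps from E to the syzygies. -/
theorem isGorensteinInjective_iff (N : ModuleCat.{u} R) :
    IsGorensteinInjective N ↔ ∃ (M J : ℤ → ModuleCat.{u} R)
      (f : ∀ i, M (i + 1) →ₗ[R] J i) (g : ∀ i, J i →ₗ[R] M i),
      (∀ i, IsInjectiveSES (f i) (g i)) ∧ Nonempty (N ≃ₗ[R] M 1) := by
  constructor
  · rintro ⟨J, hJ, hac, hE, ⟨e⟩⟩
    rw [acyclic_iff_forall] at hac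
    have hd : ∀ (i : ℤ) (x : J.X (i + 1 + 1)), J.d (i + 1) i (J.d (i + 1 + 1) (i + 1) x) = 0 :=
      fun i x => by
        rw [← ModuleCat.comp_apply, J.d_comp_d]; rfl
    -- The syzygies are taken as cokernels, and acyclicity makes the induced maps `f i` injective.
    -- The image of J₁ → J₀ is the cokernel of J₂ → J₁, hence the index 1.
    let f : ∀ i : ℤ, (J.X (i + 1) ⧸ LinearMap.range (J.d (i + 1 + 1) (i + 1)).hom) →ₗ[R] J.X i :=
      fun i => Submodule.liftQ _ (J.d (i + 1) i).hom (by
        rintro _ ⟨x, rfl⟩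
        exact hd i x)
    have hf : ∀ i, Function.Injective (f i) := fun i => by
      rw [← LinearMap.ker_eq_bot, eq_bot_iff]
      intro x hx
      obtain ⟨x, rfl⟩ := Submodule.Quotient.mk_surjective _ x
      obtain ⟨y, hy⟩ := hac i x hx
      exact (Submodule.Quotient.mk_eq_zero _).2 ⟨y, hy⟩
    refine ⟨fun i => ModuleCat.of R (J.X i ⧸ LinearMap.range (J.d (i + 1) i).hom), J.X, f,
      fun i => Submodule.mkQ _, fun i => ⟨?_, hf i, Submodule.mkQ_surjective _, ?_, ?_⟩, ⟨?_⟩⟩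
    · exact (Module.injective_iff_injective_object R (J.X i)).2 (hJ i)
    · rw [LinearMap.exact_iff, Submodule.ker_mkQ, Submodule.range_liftQ]
    · intro E hEinj w
      obtain ⟨j, rfl⟩ : ∃ j : ℤ, i = j + 1 := ⟨i - 1, by ring⟩
      have h := (linearCoyoneda_acyclic_iff E J).1
        (hE E ((Module.injective_iff_injective_object R E).1 hEinj))
      obtain ⟨l, rfl⟩ : ∃ l : ℤ, j = l + 1 := ⟨j - 1, by ring⟩
      obtain ⟨v, hv⟩ := h l (ModuleCat.ofHom (f (l + 1) ∘ₗ w)) (by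
        ext x
        obtain ⟨y, hy⟩ := Submodule.Quotient.mk_surjective _ (w x)
        change J.d (l + 1) l (f (l + 1) (w x)) = 0
        rw [← hy]
        exact hd l y)
      refine ⟨v.hom, LinearMap.ext fun x => hf (l + 1) ?_⟩
      exact congrArg (fun φ => φ.hom x) hv
    · refine (e ≪≫ ModuleCat.imageIsoRange _).toLinearEquiv ≪≫ₗ ?_
      refine LinearEquiv.symm (LinearEquiv.ofInjective (f 0) (hf 0) ≪≫ₗ LinearEquiv.ofEq _ _ ?_)
      exact Submodule.range_liftQ _ _ _
  · rintro ⟨M, J, f, g, h, ⟨e⟩⟩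
    let D : ChainComplex (ModuleCat.{u} R) ℤ := ChainComplex.of J
      (fun i => ModuleCat.ofHom (f i ∘ₗ g (i + 1))) (fun i => by
        ext x
        change f i (g (i + 1) (f (i + 1) (g (i + 1 + 1) x))) = 0
        rw [(h (i + 1)).exact.apply_apply_eq_zero, map_zero])
    have hD : ∀ i : ℤ, D.d (i + 1) i = ModuleCat.ofHom (f i ∘ₗ g (i + 1)) := fun i =>
      ChainComplex.of_d J (fun i => ModuleCat.ofHom (f i ∘ₗ g (i + 1))) i
    refine ⟨D, fun i => (Module.injective_iff_injective_object R (J i)).1 (h i).injective_mid,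
      ?_, ?_, ⟨?_⟩⟩
    · rw [acyclic_iff_forall]
      intro i x hx
      rw [hD] at hx
      have hx' : g (i + 1) x = 0 := (h i).f_injective (by simpa using hx)
      obtain ⟨z, hz⟩ := ((h (i + 1)).exact x).1 hx'
      obtain ⟨y, rfl⟩ := (h (i + 1 + 1)).g_surjective z
      refine ⟨y, ?_⟩
      rw [hD]
      exact hz
    · intro E hE
      rw [linearCoyoneda_acyclic_iff]
      intro i x hx
      rw [hD] at hx
      have hx' : ∀ t, g (i + 1) (x.hom t) = 0 := fun t => (h i).f_injective (by
        simpa using congrArg (fun φ => φ.hom t) hx)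
      have hr : ∀ t, x.hom t ∈ LinearMap.range (f (i + 1)) := fun t =>
        ((h (i + 1)).exact _).1 (hx' t)
      let q := LinearEquiv.ofInjective (f (i + 1)) (h (i + 1)).f_injective
      obtain ⟨v, hv⟩ := (h (i + 1 + 1)).lift E ((Module.injective_iff_injective_object R E).2 hE)
        (q.symm.toLinearMap ∘ₗ x.hom.codRestrict _ hr)
      refine ⟨ModuleCat.ofHom v, ?_⟩
      rw [hD]
      ext t
      change f (i + 1) ((g (i + 1 + 1) ∘ₗ v) t) = x.hom t
      rw [hv]
      change ((q (q.symm ⟨x.hom t, hr t⟩) : LinearMap.range (f (i + 1))) : J (i + 1)) = _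
      rw [LinearEquiv.apply_symm_apply]
    · have h1 : D.d 1 0 = ModuleCat.ofHom (f 0 ∘ₗ g 1) := hD 0
      refine Iso.trans (LinearEquiv.toModuleIso (?_ : N ≃ₗ[R] LinearMap.range (D.d 1 0).hom))
        (ModuleCat.imageIsoRange (D.d 1 0)).symm
      refine e ≪≫ₗ (LinearEquiv.ofInjective (f 0) (h 0).f_injective) ≪≫ₗ
        (LinearEquiv.ofEq _ _ ?_)
      rw [h1]
      exact (LinearMap.range_comp_of_range_eq_top _
        (LinearMap.range_eq_top.2 (h 1).g_surjective)).symm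

/-- There is a short exact sequence `0 → K → J → N → 0` as in `IsInjectiveSES`. -/
def InjectiveSESBetween (K N : ModuleCat.{u} R) : Prop :=
  ∃ (J : ModuleCat.{u} R) (f : K →ₗ[R] J) (g : J →ₗ[R] N), IsInjectiveSES f g

lemma IsInjectiveSES.comp_equiv_left {K K' J N : Type u} [AddCommGroup K] [Module R K]
    [AddCommGroup K'] [Module R K'] [AddCommGroup J] [Module R J] [AddCommGroup N] [Module R N]
    {f : K →ₗ[R] J} {g : J →ₗ[R] N} (h : IsInjectiveSES f g) (e : K' ≃ₗ[R] K) :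
    IsInjectiveSES (f ∘ₗ e.toLinearMap) g where
  injective_mid := h.injective_mid
  f_injective := h.f_injective.comp e.injective
  g_surjective := h.g_surjective
  exact := by
    rw [LinearMap.exact_iff, LinearMap.range_comp_of_range_eq_top _ e.range]
    exact (LinearMap.exact_iff).1 h.exact
  lift := h.lift

lemma IsInjectiveSES.comp_equiv_right {K J N N' : Type u} [AddCommGroup K] [Module R K]
    [AddCommGroup J] [Module R J] [AddCommGroup N] [Module R N] [AddCommGroup N'] [Module R N']
    {f : K →ₗ[R] J} {g : J →ₗ[R] N} (h : IsInjectiveSES f g) (e : N ≃ₗ[R] N') :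
    IsInjectiveSES f (e.toLinearMap ∘ₗ g) where
  injective_mid := h.injective_mid
  f_injective := h.f_injective
  g_surjective := e.surjective.comp h.g_surjective
  exact := by
    rw [LinearMap.exact_iff, LinearEquiv.ker_comp]
    exact (LinearMap.exact_iff).1 h.exact
  lift := fun E hE w => by
    obtain ⟨v, hv⟩ := h.lift E hE (e.symm.toLinearMap ∘ₗ w)
    refine ⟨v, LinearMap.ext fun x => ?_⟩
    have := congrArg e (LinearMap.congr_fun hv x)
    simpa using this

theorem isGorensteinInjective_iff_exists_sequence (N : ModuleCat.{u} R) :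
    IsGorensteinInjective N ↔ ∃ M : ℤ → ModuleCat.{u} R,
      (∀ i, InjectiveSESBetween (M (i + 1)) (M i)) ∧ Nonempty (N ≃ₗ[R] M 0) := by
  rw [isGorensteinInjective_iff]
  constructor
  · rintro ⟨M, J, f, g, h, ⟨e⟩⟩
    exact ⟨fun i => M (i + 1), fun i => ⟨_, _, _, h (i + 1)⟩, ⟨e⟩⟩
  · rintro ⟨M, h, ⟨e⟩⟩
    have h' : ∀ i, InjectiveSESBetween (M (i + 1 - 1)) (M (i - 1)) := fun i => by
      rw [show i + 1 - 1 = i - 1 + 1 by ring]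
      exact h (i - 1)
    choose J f g hfg using h'
    exact ⟨fun i => M (i - 1), J, f, g, hfg, ⟨e⟩⟩

lemma IsGorensteinInjective.of_equiv {N N' : ModuleCat.{u} R} (h : IsGorensteinInjective N)
    (e : N ≃ₗ[R] N') : IsGorensteinInjective N' := by
  rw [isGorensteinInjective_iff_exists_sequence] at h ⊢
  obtain ⟨M, h, ⟨e'⟩⟩ := h
  exact ⟨M, h, ⟨e.symm ≪≫ₗ e'⟩⟩

/-- A Gorenstein injective module is a quotient of an injective module by a Gorenstein injective
submodule. -/
theorem IsGorensteinInjective.exists_left {N : ModuleCat.{u} R} (h : IsGorensteinInjective N) :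
    ∃ K : ModuleCat.{u} R, IsGorensteinInjective K ∧ InjectiveSESBetween K N := by
  obtain ⟨M, h, ⟨e⟩⟩ := (isGorensteinInjective_iff_exists_sequence N).1 h
  refine ⟨M (0 + 1), (isGorensteinInjective_iff_exists_sequence _).2
    ⟨fun i => M (i + 1), fun i => h (i + 1), ⟨LinearEquiv.refl _ _⟩⟩, ?_⟩
  obtain ⟨J, f, g, hfg⟩ := h 0
  exact ⟨J, f, _, hfg.comp_equiv_right e.symm⟩

/-- A Gorenstein injective module embeds in an injective module with Gorenstein injective
cokernel. -/
theorem IsGorensteinInjective.exists_right {N : ModuleCat.{u} R} (h : IsGorensteinInjective N) :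
    ∃ C : ModuleCat.{u} R, IsGorensteinInjective C ∧ InjectiveSESBetween N C := by
  obtain ⟨M, h, ⟨e⟩⟩ := (isGorensteinInjective_iff_exists_sequence N).1 h
  refine ⟨M (0 - 1), (isGorensteinInjective_iff_exists_sequence _).2
    ⟨fun i => M (i - 1), fun i => ?_, ⟨LinearEquiv.refl _ _⟩⟩, ?_⟩
  · change InjectiveSESBetween (M (i + 1 - 1)) (M (i - 1))
    rw [show i + 1 - 1 = i - 1 + 1 by ring]
    exact h (i - 1)
  · obtain ⟨J, f, g, hfg⟩ := h (-1)
    exact ⟨J, _, _, hfg.comp_equiv_left e⟩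

/-- Coinduction principle for Gorenstein injective modules. -/
theorem IsGorensteinInjective.of_class (P : ModuleCat.{u} R → Prop)
    (hl : ∀ N, P N → ∃ K, P K ∧ InjectiveSESBetween K N)
    (hr : ∀ N, P N → ∃ C, P C ∧ InjectiveSESBetween N C) {N : ModuleCat.{u} R} (hN : P N) :
    IsGorensteinInjective N := by
  choose l hlP hl using hl
  choose r hrP hr using hr
  -- `up n` becomes the syzygy of index n and `down n` that of index -(n + 1); `N` itself sits at 0.
  let up : ℕ → {M // P M} := fun n => Nat.rec ⟨N, hN⟩ (fun _ M => ⟨l M.1 M.2, hlP M.1 M.2⟩) n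
  let down : ℕ → {M // P M} := fun n =>
    Nat.rec ⟨r N hN, hrP N hN⟩ (fun _ M => ⟨r M.1 M.2, hrP M.1 M.2⟩) n
  let M : ℤ → ModuleCat.{u} R := fun i => Int.casesOn i (fun n => (up n).1) (fun n => (down n).1)
  refine (isGorensteinInjective_iff_exists_sequence N).2 ⟨M, fun i => ?_, ⟨LinearEquiv.refl _ _⟩⟩
  rcases i with n | n
  · exact hl (up n).1 (up n).2
  · cases n with
    | zero => exact hr N hN
    | succ n =>
      rw [show Int.negSucc (n + 1) + 1 = Int.negSucc n by omega]
      exact hr (down n).1 (down n).2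

lemma isInjectiveSES_zero_left (E : ModuleCat.{u} R) (hE : Module.Injective R E) :
    InjectiveSESBetween (ModuleCat.of R PUnit.{u + 1}) E :=
  ⟨E, 0, LinearMap.id, hE, fun _ _ _ => rfl, fun x => ⟨x, rfl⟩, fun _ =>
    ⟨fun h => ⟨0, h.symm⟩, fun ⟨_, h⟩ => h.symm⟩, fun _ _ w => ⟨w, rfl⟩⟩

lemma isInjectiveSES_zero_right (E : ModuleCat.{u} R) (hE : Module.Injective R E) :
    InjectiveSESBetween E (ModuleCat.of R PUnit.{u + 1}) :=
  ⟨E, LinearMap.id, 0, hE, fun _ _ h => h, fun _ => ⟨0, rfl⟩, fun x =>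
    ⟨fun _ => ⟨x, rfl⟩, fun _ => rfl⟩, fun _ _ _ => ⟨0, rfl⟩⟩

lemma module_injective_of_subsingleton (E : Type u) [AddCommGroup E] [Module R E]
    [Subsingleton E] : Module.Injective R E :=
  ⟨fun _ _ _ _ _ _ _ _ _ => ⟨0, fun _ => Subsingleton.elim _ _⟩⟩

theorem isGorensteinInjective_of_injective {E : ModuleCat.{u} R} (hE : Module.Injective R E) :
    IsGorensteinInjective E :=
  IsGorensteinInjective.of_class (fun E => Module.Injective R E)
    (fun E hE => ⟨_, module_injective_of_subsingleton _, isInjectiveSES_zero_left E hE⟩)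
    (fun E hE => ⟨_, module_injective_of_subsingleton _, isInjectiveSES_zero_right E hE⟩) hE

theorem isGorensteinInjective_of_subsingleton (E : ModuleCat.{u} R) [Subsingleton E] :
    IsGorensteinInjective E :=
  isGorensteinInjective_of_injective (module_injective_of_subsingleton E)

/-- Derived completion replaces terms by countable powers, so closure under products is needed. -/
theorem isGorensteinInjective_pi {ι : Type} {N : ι → ModuleCat.{u} R}
    (hN : ∀ i, IsGorensteinInjective (N i)) :
    IsGorensteinInjective (ModuleCat.of R (∀ i, N i)) := by
  have key : ∀ {K N : ι → ModuleCat.{u} R}, (∀ i, InjectiveSESBetween (K i) (N i)) →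
      InjectiveSESBetween (ModuleCat.of R (∀ i, K i)) (ModuleCat.of R (∀ i, N i)) := by
    intro K N h
    choose J f g h using h
    have := fun i => (h i).injective_mid
    refine ⟨ModuleCat.of R (∀ i, J i), LinearMap.pi fun i => f i ∘ₗ LinearMap.proj i,
      LinearMap.pi fun i => g i ∘ₗ LinearMap.proj i, inferInstanceAs (Module.Injective R (∀ i, J i)),
      fun x y hxy => funext fun i => (h i).f_injective (congrFun hxy i), fun y => ?_, fun x => ?_,
      fun E hE w => ?_⟩
    · choose x hx using fun i => (h i).g_surjective (y i)
      exact ⟨x, funext hx⟩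
    · constructor
      · intro hx
        choose y hy using fun i => ((h i).exact (x i)).1 (congrFun hx i)
        exact ⟨y, funext hy⟩
      · rintro ⟨y, rfl⟩
        exact funext fun i => (h i).exact.apply_apply_eq_zero (y i)
    · choose v hv using fun i => (h i).lift E hE (LinearMap.proj i ∘ₗ w)
      exact ⟨LinearMap.pi v, LinearMap.ext fun x => funext fun i => LinearMap.congr_fun (hv i) x⟩
  refine IsGorensteinInjective.of_class
    (fun M => ∃ N : ι → ModuleCat.{u} R, (∀ i, IsGorensteinInjective (N i)) ∧
      M = ModuleCat.of R (∀ i, N i)) ?_ ?_ ⟨N, hN, rfl⟩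
  · rintro _ ⟨N, hN, rfl⟩
    choose K hK hKN using fun i => (hN i).exists_left
    exact ⟨_, ⟨K, hK, rfl⟩, key hKN⟩
  · rintro _ ⟨N, hN, rfl⟩
    choose K hK hKN using fun i => (hN i).exists_right
    exact ⟨_, ⟨K, hK, rfl⟩, key hKN⟩

/-- `Ext¹(E, N) = 0` for `E` injective and `N` Gorenstein injective. -/
theorem IsGorensteinInjective.exists_lift {N : ModuleCat.{u} R} (hN : IsGorensteinInjective N)
    {Y W : Type u} [AddCommGroup Y] [Module R Y] [AddCommGroup W] [Module R W]
    (i : N →ₗ[R] Y) (p : Y →ₗ[R] W) (hi : Function.Injective i) (hp : Function.Surjective p)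
    (hip : Function.Exact i p) (E : ModuleCat.{u} R) (hE : Module.Injective R E)
    (w : E →ₗ[R] W) : ∃ v : E →ₗ[R] Y, p ∘ₗ v = w := by
  obtain ⟨C, -, J, f, g, h⟩ := hN.exists_right
  have := h.injective_mid
  -- `Y` is the pullback of J → C ← W: `(a, p)` embeds it in J × W with that image. A lift `l` of `b
  -- ∘ w` to J then gives the point `(l, w)` of the pullback.
  obtain ⟨a, ha⟩ := Module.Injective.extension_property R _ _ _ i hi f
  obtain ⟨b, hb⟩ := exists_comp_eq_of_ker_le hp (g ∘ₗ a) (fun y hy => by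
    obtain ⟨n, rfl⟩ := (hip y).1 hy
    change g ((a ∘ₗ i) n) = 0
    rw [ha, h.exact.apply_apply_eq_zero])
  obtain ⟨l, hl⟩ := h.lift E hE (b ∘ₗ w)
  have hinj : Function.Injective (a.prod p) := by
    rw [injective_iff_map_eq_zero]
    intro y hy
    obtain ⟨n, rfl⟩ := (hip y).1 (congrArg Prod.snd hy)
    have : f n = 0 := by rw [← ha]; exact congrArg Prod.fst hy
    rw [h.f_injective (this.trans (map_zero f).symm), map_zero]
  have hrange : ∀ x, (l.prod w) x ∈ LinearMap.range (a.prod p) := fun x => by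
    obtain ⟨y, hy⟩ := hp (w x)
    have : g (l x - a y) = 0 := by
      have h1 := LinearMap.congr_fun hl x
      have h2 := LinearMap.congr_fun hb y
      simp only [LinearMap.comp_apply] at h1 h2
      rw [map_sub, h1, ← h2, hy, sub_self]
    obtain ⟨n, hn⟩ := (h.exact _).1 this
    refine ⟨y + i n, Prod.ext ?_ ?_⟩
    · have := LinearMap.congr_fun ha n
      simp only [LinearMap.comp_apply] at this
      change a (y + i n) = l x
      rw [map_add, this, hn, add_sub_cancel]
    · change p (y + i n) = w x
      rw [map_add, hip.apply_apply_eq_zero, add_zero, hy]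
  obtain ⟨v, hv⟩ := exists_comp_eq_of_mem_range hinj _ hrange
  exact ⟨v, LinearMap.ext fun x => congrArg Prod.snd (LinearMap.congr_fun hv x)⟩

lemma module_injective_prod {J₁ J₂ : Type u} [AddCommGroup J₁] [Module R J₁] [AddCommGroup J₂]
    [Module R J₂] (h₁ : Module.Injective R J₁) (h₂ : Module.Injective R J₂) :
    Module.Injective R (J₁ × J₂) :=
  ⟨fun X Y _ _ _ _ f hf g => by
    obtain ⟨a, ha⟩ := h₁.out f hf (LinearMap.fst R J₁ J₂ ∘ₗ g)
    obtain ⟨b, hb⟩ := h₂.out f hf (LinearMap.snd R J₁ J₂ ∘ₗ g)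
    exact ⟨a.prod b, fun x => Prod.ext (ha x) (hb x)⟩⟩

/-- The middle term of a short exact sequence with Gorenstein injective ends. -/
def IsGorensteinInjectiveExtension (M : ModuleCat.{u} R) : Prop :=
  ∃ (M₁ M₂ : ModuleCat.{u} R) (i : M₁ →ₗ[R] M) (p : M →ₗ[R] M₂), IsGorensteinInjective M₁ ∧
    IsGorensteinInjective M₂ ∧ Function.Injective i ∧ Function.Surjective p ∧ Function.Exact i p

/-- Horseshoe lemma: J₁ × J₂ covers M, and the kernel is an extension of K₂ by K₁. -/
lemma IsGorensteinInjectiveExtension.exists_left {M : ModuleCat.{u} R}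
    (hM : IsGorensteinInjectiveExtension M) :
    ∃ K, IsGorensteinInjectiveExtension K ∧ InjectiveSESBetween K M := by
  obtain ⟨M₁, M₂, i, p, h₁, h₂, hi, hp, hip⟩ := hM
  obtain ⟨K₁, hK₁, J₁, f₁, g₁, s₁⟩ := h₁.exists_left
  obtain ⟨K₂, hK₂, J₂, f₂, g₂, s₂⟩ := h₂.exists_left
  -- Ext¹(J₂, M₁) = 0 replaces the projectivity used in the ordinary horseshoe lemma.
  obtain ⟨v, hv⟩ := h₁.exists_lift i p hi hp hip J₂ s₂.injective_mid g₂
  replace hv : ∀ b, p (v b) = g₂ b := LinearMap.congr_fun hv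
  let φ : J₁ × J₂ →ₗ[R] M := (i ∘ₗ g₁).coprod v
  have hφ : ∀ a b, φ (a, b) = i (g₁ a) + v b := fun a b => LinearMap.coprod_apply _ _ _
  have hpφ : ∀ x, p (φ x) = g₂ x.2 := fun x => by
    rw [← Prod.mk.eta (p := x), hφ, map_add, hip.apply_apply_eq_zero, zero_add, hv]
  obtain ⟨q, hq⟩ := exists_comp_eq_of_mem_range s₂.f_injective
    (LinearMap.snd R J₁ J₂ ∘ₗ (LinearMap.ker φ).subtype) (fun x => by
      refine (s₂.exact _).1 ?_
      change g₂ x.1.2 = 0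
      rw [← hpφ, x.2, map_zero])
  replace hq : ∀ x, f₂ (q x) = x.1.2 := LinearMap.congr_fun hq
  refine ⟨ModuleCat.of R (LinearMap.ker φ), ⟨K₁, K₂,
    (LinearMap.inl R J₁ J₂ ∘ₗ f₁).codRestrict _ ?_, q, hK₁, hK₂, ?_, ?_, ?_⟩,
    ModuleCat.of R (J₁ × J₂), (LinearMap.ker φ).subtype, φ,
    module_injective_prod s₁.injective_mid s₂.injective_mid, Submodule.subtype_injective _,
    ?_, ?_, ?_⟩
  · intro x
    change φ (f₁ x, 0) = 0
    rw [hφ, s₁.exact.apply_apply_eq_zero, map_zero, map_zero, add_zero]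
  · intro x y hxy
    exact s₁.f_injective (congrArg (fun t => t.1.1) hxy)
  · intro y
    obtain ⟨m, hm⟩ := (hip (v (f₂ y))).1 (by rw [hv, s₂.exact.apply_apply_eq_zero])
    obtain ⟨a, rfl⟩ := s₁.g_surjective m
    refine ⟨⟨(-a, f₂ y), ?_⟩, s₂.f_injective (hq _)⟩
    rw [LinearMap.mem_ker, hφ, map_neg, map_neg, hm, neg_add_cancel]
  · rintro ⟨⟨a, b⟩, hab⟩
    constructor
    · intro h
      have hb : b = 0 := by
        have := hq ⟨⟨a, b⟩, hab⟩
        rw [h, map_zero] at this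
        exact this.symm
      subst hb
      rw [LinearMap.mem_ker, hφ, map_zero, add_zero] at hab
      obtain ⟨k, hk⟩ := (s₁.exact a).1 (hi (hab.trans (map_zero i).symm))
      exact ⟨k, Subtype.ext (Prod.ext hk rfl)⟩
    · rintro ⟨k, hk⟩
      refine s₂.f_injective ?_
      rw [hq, map_zero, ← hk]
      rfl
  · intro m
    obtain ⟨b, hb⟩ := s₂.g_surjective (p m)
    obtain ⟨m₁, hm₁⟩ := (hip (m - v b)).1 (by rw [map_sub, hv, hb, sub_self])
    obtain ⟨a, rfl⟩ := s₁.g_surjective m₁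
    exact ⟨(a, b), by rw [hφ, hm₁, sub_add_cancel]⟩
  · intro x
    exact ⟨fun h => ⟨⟨x, h⟩, rfl⟩, by rintro ⟨y, rfl⟩; exact y.2⟩
  · intro E hE w
    obtain ⟨b, hb⟩ := s₂.lift E hE (p ∘ₗ w)
    replace hb : ∀ x, g₂ (b x) = p (w x) := LinearMap.congr_fun hb
    obtain ⟨c, hc⟩ := exists_comp_eq_of_mem_range hi (w - v ∘ₗ b) (fun x => by
      refine (hip _).1 ?_
      rw [LinearMap.sub_apply, map_sub, LinearMap.comp_apply, hv, hb, sub_self])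
    obtain ⟨a, ha⟩ := s₁.lift E hE c
    refine ⟨a.prod b, LinearMap.ext fun x => ?_⟩
    have h1 : g₁ (a x) = c x := LinearMap.congr_fun ha x
    have h2 : i (c x) = w x - v (b x) := LinearMap.congr_fun hc x
    change φ (a x, b x) = w x
    rw [hφ, h1, h2, sub_add_cancel]

/-- Dual horseshoe: `f₁` extends to M by injectivity of J₁, and the cokernel of M → J₁ × J₂ is an
extension of C₂ by C₁. -/
lemma IsGorensteinInjectiveExtension.exists_right {M : ModuleCat.{u} R}
    (hM : IsGorensteinInjectiveExtension M) :
    ∃ C, IsGorensteinInjectiveExtension C ∧ InjectiveSESBetween M C := by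
  obtain ⟨M₁, M₂, i, p, h₁, h₂, hi, hp, hip⟩ := hM
  obtain ⟨C₁, hC₁, J₁, f₁, g₁, s₁⟩ := h₁.exists_right
  obtain ⟨C₂, hC₂, J₂, f₂, g₂, s₂⟩ := h₂.exists_right
  have := s₁.injective_mid
  obtain ⟨a, ha⟩ := Module.Injective.extension_property R _ _ _ i hi f₁
  replace ha : ∀ x, a (i x) = f₁ x := LinearMap.congr_fun ha
  let φ : M →ₗ[R] J₁ × J₂ := a.prod (f₂ ∘ₗ p)
  have hφ : ∀ m, φ m = (a m, f₂ (p m)) := fun m => rfl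
  let π : J₁ × J₂ →ₗ[R] (J₁ × J₂) ⧸ LinearMap.range φ := Submodule.mkQ _
  have hπ : Function.Surjective π := Submodule.mkQ_surjective _
  have hπ0 : ∀ x, π x = 0 ↔ x ∈ LinearMap.range φ := fun x => Submodule.Quotient.mk_eq_zero _
  obtain ⟨c, hc⟩ := exists_comp_eq_of_ker_le s₁.g_surjective (π ∘ₗ LinearMap.inl R J₁ J₂)
    (fun x hx => by
      obtain ⟨m, rfl⟩ := (s₁.exact x).1 hx
      refine (hπ0 _).2 ⟨i m, ?_⟩
      rw [hφ, ha, hip.apply_apply_eq_zero, map_zero]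
      rfl)
  replace hc : ∀ x, c (g₁ x) = π (x, 0) := LinearMap.congr_fun hc
  obtain ⟨q, hq⟩ := exists_comp_eq_of_ker_le hπ (g₂ ∘ₗ LinearMap.snd R J₁ J₂)
    (fun x hx => by
      obtain ⟨m, rfl⟩ := (hπ0 x).1 hx
      exact s₂.exact.apply_apply_eq_zero _)
  replace hq : ∀ x, q (π x) = g₂ x.2 := LinearMap.congr_fun hq
  have hcinj : Function.Injective c := by
    rw [injective_iff_map_eq_zero]
    intro y hy
    obtain ⟨x, rfl⟩ := s₁.g_surjective y
    rw [hc, hπ0] at hy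
    obtain ⟨m, hm⟩ := hy
    obtain ⟨m₁, rfl⟩ := (hip m).1 (s₂.f_injective ((congrArg Prod.snd hm).trans (map_zero f₂).symm))
    have : a (i m₁) = x := congrArg Prod.fst hm
    rw [← this, ha, s₁.exact.apply_apply_eq_zero]
  have hcq : Function.Exact c q := by
    intro y
    obtain ⟨⟨x₁, x₂⟩, rfl⟩ := hπ y
    constructor
    · intro h
      rw [hq] at h
      obtain ⟨m₂, hm₂⟩ := (s₂.exact x₂).1 h
      obtain ⟨m, rfl⟩ := hp m₂
      refine ⟨g₁ (x₁ - a m), ?_⟩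
      rw [hc, ← sub_eq_zero, ← map_sub, hπ0]
      refine ⟨-m, ?_⟩
      rw [map_neg, hφ, hm₂]
      ext <;> simp
    · rintro ⟨z, hz⟩
      obtain ⟨x, rfl⟩ := s₁.g_surjective z
      rw [← hz, hc, hq, map_zero]
  refine ⟨ModuleCat.of R ((J₁ × J₂) ⧸ LinearMap.range φ), ⟨C₁, C₂, c, q, hC₁, hC₂, hcinj, ?_, hcq⟩,
    ModuleCat.of R (J₁ × J₂), φ, π, module_injective_prod s₁.injective_mid s₂.injective_mid,
    ?_, hπ, hπ0, ?_⟩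
  · intro z
    obtain ⟨x, rfl⟩ := s₂.g_surjective z
    exact ⟨π (0, x), hq _⟩
  · rw [injective_iff_map_eq_zero]
    intro m hm
    obtain ⟨m₁, rfl⟩ := (hip m).1 (s₂.f_injective ((congrArg Prod.snd hm).trans (map_zero f₂).symm))
    have : f₁ m₁ = 0 := (ha m₁).symm.trans (congrArg Prod.fst hm)
    rw [s₁.f_injective (this.trans (map_zero f₁).symm), map_zero]
  · intro E hE w
    obtain ⟨b, hb⟩ := s₂.lift E hE (q ∘ₗ w)
    replace hb : ∀ x, g₂ (b x) = q (w x) := LinearMap.congr_fun hb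
    obtain ⟨e, he⟩ := exists_comp_eq_of_mem_range hcinj (w - π ∘ₗ LinearMap.inr R J₁ J₂ ∘ₗ b)
      (fun x => by
        refine (hcq _).1 ?_
        change q (w x - π (0, b x)) = 0
        rw [map_sub, hq, hb, sub_self])
    obtain ⟨d, hd⟩ := s₁.lift E hE e
    refine ⟨d.prod b, LinearMap.ext fun x => ?_⟩
    have h1 : g₁ (d x) = e x := LinearMap.congr_fun hd x
    have h2 : c (e x) = w x - π (0, b x) := LinearMap.congr_fun he x
    change π (d x, b x) = w x
    have h3 : ((d x, b x) : J₁ × J₂) = (d x, 0) + (0, b x) := by simp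
    rw [h3, map_add, ← hc, h1, h2, sub_add_cancel]

/-- Gorenstein injective modules are closed under extensions. -/
theorem IsGorensteinInjective.of_shortExact {M₁ M M₂ : ModuleCat.{u} R}
    (h₁ : IsGorensteinInjective M₁) (h₂ : IsGorensteinInjective M₂)
    (i : M₁ →ₗ[R] M) (p : M →ₗ[R] M₂) (hi : Function.Injective i) (hp : Function.Surjective p)
    (hip : Function.Exact i p) : IsGorensteinInjective M :=
  IsGorensteinInjective.of_class IsGorensteinInjectiveExtension
    (fun _ h => h.exists_left) (fun _ h => h.exists_right) ⟨M₁, M₂, i, p, h₁, h₂, hi, hp, hip⟩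

theorem IsGorensteinInjective.prod {M₁ M₂ : ModuleCat.{u} R} (h₁ : IsGorensteinInjective M₁)
    (h₂ : IsGorensteinInjective M₂) : IsGorensteinInjective (ModuleCat.of R (M₁ × M₂)) :=
  IsGorensteinInjective.of_shortExact (M := ModuleCat.of R (M₁ × M₂)) h₁ h₂
    (LinearMap.inl R M₁ M₂) (LinearMap.snd R M₁ M₂) LinearMap.inl_injective
    LinearMap.snd_surjective Function.Exact.inl_snd

end GorensteinInjective

/-! ### Dimension shifting and exact sequences for Tor -/

section TorVanishing

open MonoidalCategory

variable {R : Type u} [CommRing R]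

/-- Vanishing of `Tor_n(X, M)`. -/
def TorVanishes (n : ℕ) (X M : ModuleCat.{u} R) : Prop :=
  IsZero (((Tor (ModuleCat.{u} R) n).obj X).obj M)

/-- The complex `X ⊗ P`. -/
noncomputable abbrev tensorComplex (X : ModuleCat.{u} R) (P : ChainComplex (ModuleCat.{u} R) ℕ) :
    ChainComplex (ModuleCat.{u} R) ℕ :=
  (((tensoringLeft (ModuleCat.{u} R)).obj X).mapHomologicalComplex (ComplexShape.down ℕ)).obj P

lemma torVanishes_iff_isZero_homology {M : ModuleCat.{u} R} (P : ProjectiveResolution M) (n : ℕ)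
    (X : ModuleCat.{u} R) :
    TorVanishes n X M ↔ IsZero ((tensorComplex X P.complex).homology n) :=
  (P.isoLeftDerivedObj ((tensoringLeft (ModuleCat.{u} R)).obj X) n).isZero_iff

lemma torVanishes_zero_iff (X M : ModuleCat.{u} R) :
    TorVanishes 0 X M ↔ Subsingleton (TensorProduct R X M) := by
  have : PreservesFiniteColimits ((tensoringLeft (ModuleCat.{u} R)).obj X) :=
    inferInstanceAs (PreservesFiniteColimits (tensorLeft X))
  refine ((((tensoringLeft (ModuleCat.{u} R)).obj X).leftDerivedZeroIsoSelf).app M).isZero_iff.trans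
    ?_
  exact ModuleCat.isZero_iff_subsingleton

lemma isZero_homology_tensorComplex_of_flat {M : ModuleCat.{u} R} (P : ProjectiveResolution M)
    (n : ℕ) (F : ModuleCat.{u} R) [Module.Flat R F] :
    IsZero ((tensorComplex F P.complex).homology (n + 1)) := by
  rw [← HomologicalComplex.exactAt_iff_isZero_homology,
    HomologicalComplex.exactAt_iff' _ (n + 2) (n + 1) n (by simp) (by simp)]
  have h := P.complex_exactAt_succ n
  rw [HomologicalComplex.exactAt_iff' _ (n + 2) (n + 1) n (by simp) (by simp),
    ShortComplex.ShortExact.moduleCat_exact_iff_function_exact] at h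
  rw [ShortComplex.ShortExact.moduleCat_exact_iff_function_exact]
  exact Module.Flat.lTensor_exact F (f := (P.complex.d (n + 2) (n + 1)).hom)
    (g := (P.complex.d (n + 1) n).hom) h

/-- The sequence of complexes obtained from a short complex by tensoring with `P`. -/
noncomputable abbrev tensorShortComplex (S : ShortComplex (ModuleCat.{u} R))
    (P : ChainComplex (ModuleCat.{u} R) ℕ) :
    ShortComplex (ChainComplex (ModuleCat.{u} R) ℕ) :=
  ShortComplex.mk
    ((NatTrans.mapHomologicalComplex ((tensoringLeft (ModuleCat.{u} R)).map S.f) _).app P)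
    ((NatTrans.mapHomologicalComplex ((tensoringLeft (ModuleCat.{u} R)).map S.g) _).app P) (by
      ext i : 1
      change (S.f ▷ P.X i) ≫ (S.g ▷ P.X i) = 0
      rw [← comp_whiskerRight, S.zero, MonoidalPreadditive.zero_whiskerRight])

lemma tensorShortComplex_shortExact {S : ShortComplex (ModuleCat.{u} R)} (hS : S.ShortExact)
    {M : ModuleCat.{u} R} (P : ProjectiveResolution M) :
    (tensorShortComplex S P.complex).ShortExact := by
  refine HomologicalComplex.shortExact_of_degreewise_shortExact _ fun i => ?_
  have : Module.Projective R (P.complex.X i) :=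
    (IsProjective.iff_projective (P.complex.X i)).2 (P.projective i)
  have : Module.Flat R (P.complex.X i) := inferInstance
  exact hS.map_of_exact (tensorRight (P.complex.X i))

lemma homologyMap_zero_fromLeftDerivedZero' {F G : ModuleCat.{u} R ⥤ ModuleCat.{u} R}
    [F.Additive] [G.Additive] (α : F ⟶ G) {M : ModuleCat.{u} R} (P : ProjectiveResolution M) :
    HomologicalComplex.homologyMap ((NatTrans.mapHomologicalComplex α _).app P.complex) 0 ≫
      (ChainComplex.isoHomologyι₀ _).hom ≫ P.fromLeftDerivedZero' G =
    ((ChainComplex.isoHomologyι₀ _).hom ≫ P.fromLeftDerivedZero' F) ≫ α.app M := by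
  have h : HomologicalComplex.opcyclesMap
      ((NatTrans.mapHomologicalComplex α _).app P.complex) 0 ≫ P.fromLeftDerivedZero' G =
      P.fromLeftDerivedZero' F ≫ α.app M := by
    rw [← cancel_epi (HomologicalComplex.pOpcycles _ _)]
    rw [HomologicalComplex.p_opcyclesMap_assoc, ProjectiveResolution.pOpcycles_comp_fromLeftDerivedZero',
      ProjectiveResolution.pOpcycles_comp_fromLeftDerivedZero'_assoc]
    exact (α.naturality _).symm
  rw [Category.assoc, ← h]
  simp

section FirstVariable

variable {K F X : ModuleCat.{u} R} [Module.Flat R F] {f : K →ₗ[R] F} {g : F →ₗ[R] X}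

/-- `Tor` is computed by resolving the second argument. Tensoring the sequence with the flat terms
of a resolution of M gives a long exact sequence to which F contributes nothing in positive degrees.
-/
lemma torVanishes_succ_succ_iff (hf : Function.Injective f) (hg : Function.Surjective g)
    (hfg : Function.Exact f g) (n : ℕ) (M : ModuleCat.{u} R) :
    TorVanishes (n + 2) X M ↔ TorVanishes (n + 1) K M := by
  let S : ShortComplex (ModuleCat.{u} R) :=
    ShortComplex.mk (ModuleCat.ofHom f) (ModuleCat.ofHom g)
      (ModuleCat.hom_ext (LinearMap.ext hfg.apply_apply_eq_zero))
  have hS : S.ShortExact := ModuleCat.shortComplex_shortExact S hfg hf hg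
  let P := projectiveResolution M
  have h := tensorShortComplex_shortExact hS P
  have h1 := isZero_homology_tensorComplex_of_flat P (n + 1) F
  have h2 := isZero_homology_tensorComplex_of_flat P n F
  have e1 := h.homology_exact₁ (n + 2) (n + 1) rfl
  have e3 := h.homology_exact₃ (n + 2) (n + 1) rfl
  rw [torVanishes_iff_isZero_homology P, torVanishes_iff_isZero_homology P]
  constructor
  · intro h3
    exact e1.isZero_of_both_zeros (h3.eq_of_src _ _) (h2.eq_of_tgt _ _)
  · intro h3
    exact e3.isZero_of_both_zeros (h1.eq_of_src _ _) (h3.eq_of_tgt _ _)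

/-- The same sequence identifies Tor₁ with the kernel of the map on degree zero homology, which is K
⊗ M → F ⊗ M by naturality. -/
lemma torVanishes_one_iff (hf : Function.Injective f) (hg : Function.Surjective g)
    (hfg : Function.Exact f g) (M : ModuleCat.{u} R) :
    TorVanishes 1 X M ↔ Function.Injective (f.rTensor M) := by
  let S : ShortComplex (ModuleCat.{u} R) :=
    ShortComplex.mk (ModuleCat.ofHom f) (ModuleCat.ofHom g)
      (ModuleCat.hom_ext (LinearMap.ext hfg.apply_apply_eq_zero))
  have hS : S.ShortExact := ModuleCat.shortComplex_shortExact S hfg hf hg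
  let P := projectiveResolution M
  have h := tensorShortComplex_shortExact hS P
  have h1 := isZero_homology_tensorComplex_of_flat P 0 F
  have e1 := h.homology_exact₁ 1 0 rfl
  have e3 := h.homology_exact₃ 1 0 rfl
  have hpres : ∀ Y : ModuleCat.{u} R,
      PreservesFiniteColimits ((tensoringLeft (ModuleCat.{u} R)).obj Y) :=
    fun Y => inferInstanceAs (PreservesFiniteColimits (tensorLeft Y))
  have hsq := homologyMap_zero_fromLeftDerivedZero'
    ((tensoringLeft (ModuleCat.{u} R)).map S.f) P
  have hmono : Mono (HomologicalComplex.homologyMap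
      ((NatTrans.mapHomologicalComplex ((tensoringLeft (ModuleCat.{u} R)).map S.f) _).app
        P.complex) 0) ↔ Function.Injective (f.rTensor M) := by
    have h2 : Mono (((tensoringLeft (ModuleCat.{u} R)).map S.f).app M) ↔
        Function.Injective (f.rTensor M) := ModuleCat.mono_iff_injective _
    rw [← h2]
    have := congrArg (fun φ => Mono φ) hsq
    simp only [eq_iff_iff] at this
    rwa [mono_comp_iff_of_mono, mono_comp_iff_of_isIso] at this
  rw [torVanishes_iff_isZero_homology P, ← hmono]
  constructor
  · intro h3
    exact e1.mono_g (h3.eq_of_src _ _)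
  · intro h3
    refine e3.isZero_of_both_zeros (h1.eq_of_src _ _) ?_
    have : Mono (HomologicalComplex.homologyMap (tensorShortComplex S P.complex).f 0) := h3
    rw [← cancel_mono (HomologicalComplex.homologyMap (tensorShortComplex S P.complex).f 0),
      zero_comp]
    exact h.δ_comp _ _ _

end FirstVariable

section SecondVariable

variable {A B C : ModuleCat.{u} R} {a : A →ₗ[R] B} {b : B →ₗ[R] C}

/-- Snake lemma: the kernel of X ⊗ A → X ⊗ B is reached from the kernel of K ⊗ C → F ⊗ C. -/
lemma lTensor_injective_of_rTensor_injective {K F X : ModuleCat.{u} R} [Module.Flat R F]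
    {f : K →ₗ[R] F} {g : F →ₗ[R] X} (hg : Function.Surjective g) (hfg : Function.Exact f g)
    (ha : Function.Injective a) (hb : Function.Surjective b) (hab : Function.Exact a b)
    (h : Function.Injective (f.rTensor C)) : Function.Injective (a.lTensor X) := by
  rw [injective_iff_map_eq_zero]
  intro t ht
  obtain ⟨t, rfl⟩ := g.rTensor_surjective A hg t
  have hc1 : ∀ z, a.lTensor X (g.rTensor A z) = g.rTensor B (a.lTensor F z) := fun z => by
    rw [← LinearMap.comp_apply, ← LinearMap.comp_apply, LinearMap.lTensor_comp_rTensor,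
      LinearMap.rTensor_comp_lTensor]
  have hc2 : ∀ z, b.lTensor F (f.rTensor B z) = f.rTensor C (b.lTensor K z) := fun z => by
    rw [← LinearMap.comp_apply, ← LinearMap.comp_apply, LinearMap.lTensor_comp_rTensor,
      LinearMap.rTensor_comp_lTensor]
  have hc3 : ∀ z, a.lTensor F (f.rTensor A z) = f.rTensor B (a.lTensor K z) := fun z => by
    rw [← LinearMap.comp_apply, ← LinearMap.comp_apply, LinearMap.lTensor_comp_rTensor,
      LinearMap.rTensor_comp_lTensor]
  rw [hc1] at ht
  obtain ⟨w, hw⟩ := (rTensor_exact B hfg hg _).1 ht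
  have hw0 : b.lTensor K w = 0 := h (by
    rw [← hc2, hw, (lTensor_exact F hab hb).apply_apply_eq_zero, map_zero])
  obtain ⟨v, rfl⟩ := (lTensor_exact K hab hb _).1 hw0
  rw [← hc3] at hw
  rw [← Module.Flat.lTensor_preserves_injective_linearMap (M := F) a ha hw,
    (rTensor_exact A hfg hg).apply_apply_eq_zero]

lemma exists_free_cover (X : ModuleCat.{u} R) :
    ∃ (K F : ModuleCat.{u} R) (f : K →ₗ[R] F) (g : F →ₗ[R] X), Module.Flat R F ∧
      Function.Injective f ∧ Function.Surjective g ∧ Function.Exact f g := by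
  let g : (X →₀ R) →ₗ[R] X := Finsupp.linearCombination R id
  refine ⟨ModuleCat.of R (LinearMap.ker g), ModuleCat.of R (X →₀ R), (LinearMap.ker g).subtype, g,
    inferInstanceAs (Module.Flat R (X →₀ R)), Submodule.subtype_injective _,
    Finsupp.linearCombination_id_surjective R X, ?_⟩
  exact LinearMap.exact_subtype_ker_map g

/-- Exactness of Tor_{n+1}(X, C) → Tor_n(X, A) → Tor_n(X, B), by passing to syzygies of X. The shift
only ends in positive degrees, so n = 0 and n = 1 are both base cases. -/
lemma TorVanishes.of_shortExact_left (ha : Function.Injective a) (hb : Function.Surjective b)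
    (hab : Function.Exact a b) (n : ℕ) (X : ModuleCat.{u} R) (hC : TorVanishes (n + 1) X C)
    (hB : TorVanishes n X B) : TorVanishes n X A := by
  induction n generalizing X with
  | zero =>
    obtain ⟨K, F, f, g, hF, hf, hg, hfg⟩ := exists_free_cover X
    rw [torVanishes_zero_iff] at hB ⊢
    rw [torVanishes_one_iff hf hg hfg] at hC
    exact (lTensor_injective_of_rTensor_injective hg hfg ha hb hab hC).subsingleton
  | succ n ih =>
    obtain ⟨K, F, f, g, hF, hf, hg, hfg⟩ := exists_free_cover X
    rw [torVanishes_succ_succ_iff hf hg hfg] at hC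
    cases n with
    | zero =>
      rw [torVanishes_one_iff hf hg hfg] at hB ⊢
      obtain ⟨K', F', f', g', hF', hf', hg', hfg'⟩ := exists_free_cover K
      rw [torVanishes_one_iff hf' hg' hfg'] at hC
      have h1 := hB.comp (lTensor_injective_of_rTensor_injective hg' hfg' ha hb hab hC)
      have h2 : (f.rTensor B ∘ₗ a.lTensor K : _ →ₗ[R] _) = a.lTensor F ∘ₗ f.rTensor A := by
        rw [LinearMap.lTensor_comp_rTensor, LinearMap.rTensor_comp_lTensor]
      rw [← LinearMap.coe_comp, h2, LinearMap.coe_comp] at h1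
      exact h1.of_comp
    | succ n =>
      rw [torVanishes_succ_succ_iff hf hg hfg] at hB ⊢
      exact ih K hC hB

lemma rTensor_injective_of_lTensor_injective {K F X : ModuleCat.{u} R}
    {f : K →ₗ[R] F} {g : F →ₗ[R] X} (hg : Function.Surjective g) (hfg : Function.Exact f g)
    (hb : Function.Surjective b) (hab : Function.Exact a b)
    (hA : Function.Injective (a.lTensor X)) (hB : Function.Injective (f.rTensor B)) :
    Function.Injective (f.rTensor C) := by
  rw [injective_iff_map_eq_zero]
  intro z hz
  obtain ⟨w, rfl⟩ := b.lTensor_surjective K hb z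
  have hc1 : ∀ z, a.lTensor X (g.rTensor A z) = g.rTensor B (a.lTensor F z) := fun z => by
    rw [← LinearMap.comp_apply, ← LinearMap.comp_apply, LinearMap.lTensor_comp_rTensor,
      LinearMap.rTensor_comp_lTensor]
  have hc2 : ∀ z, b.lTensor F (f.rTensor B z) = f.rTensor C (b.lTensor K z) := fun z => by
    rw [← LinearMap.comp_apply, ← LinearMap.comp_apply, LinearMap.lTensor_comp_rTensor,
      LinearMap.rTensor_comp_lTensor]
  have hc3 : ∀ z, a.lTensor F (f.rTensor A z) = f.rTensor B (a.lTensor K z) := fun z => by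
    rw [← LinearMap.comp_apply, ← LinearMap.comp_apply, LinearMap.lTensor_comp_rTensor,
      LinearMap.rTensor_comp_lTensor]
  rw [← hc2] at hz
  obtain ⟨y, hy⟩ := (lTensor_exact F hab hb _).1 hz
  obtain ⟨v, rfl⟩ := (rTensor_exact A hfg hg y).1 (hA (by
    rw [hc1, hy, (rTensor_exact B hfg hg).apply_apply_eq_zero, map_zero]))
  rw [hc3] at hy
  rw [← hB hy, (lTensor_exact K hab hb).apply_apply_eq_zero]

/-- Exactness of Tor_{n+1}(X, B) → Tor_{n+1}(X, C) → Tor_n(X, A), by the same induction. -/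
lemma TorVanishes.of_shortExact_right (ha : Function.Injective a) (hb : Function.Surjective b)
    (hab : Function.Exact a b) (n : ℕ) (X : ModuleCat.{u} R) (hB : TorVanishes (n + 1) X B)
    (hA : TorVanishes n X A) : TorVanishes (n + 1) X C := by
  induction n generalizing X with
  | zero =>
    obtain ⟨K, F, f, g, hF, hf, hg, hfg⟩ := exists_free_cover X
    rw [torVanishes_zero_iff] at hA
    rw [torVanishes_one_iff hf hg hfg] at hB ⊢
    exact rTensor_injective_of_lTensor_injective hg hfg hb hab
      (fun _ _ _ => Subsingleton.elim _ _) hB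
  | succ n ih =>
    obtain ⟨K, F, f, g, hF, hf, hg, hfg⟩ := exists_free_cover X
    rw [torVanishes_succ_succ_iff hf hg hfg] at hB ⊢
    cases n with
    | zero =>
      rw [torVanishes_one_iff hf hg hfg] at hA
      obtain ⟨K', F', f', g', hF', hf', hg', hfg'⟩ := exists_free_cover K
      rw [torVanishes_one_iff hf' hg' hfg'] at hB ⊢
      refine rTensor_injective_of_lTensor_injective hg' hfg' hb hab ?_ hB
      have h1 := (Module.Flat.lTensor_preserves_injective_linearMap (M := F) a ha).comp hA
      have h2 : (f.rTensor B ∘ₗ a.lTensor K : _ →ₗ[R] _) = a.lTensor F ∘ₗ f.rTensor A := by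
        rw [LinearMap.lTensor_comp_rTensor, LinearMap.rTensor_comp_lTensor]
      rw [← LinearMap.coe_comp, ← h2, LinearMap.coe_comp] at h1
      exact h1.of_comp
    | succ n =>
      rw [torVanishes_succ_succ_iff hf hg hfg] at hA
      exact ih K hB hA

end SecondVariable

end TorVanishing

/-! ### Tor of injective modules from Ext into the ring -/

section DualTensor

variable {R : Type u} [CommRing R]

/-- For `F` finite projective, `F ⊗ J` is the module of linear maps from the dual of `F` to `J`. -/
noncomputable def tensorEquivDualHom (F J : Type u) [AddCommGroup F] [Module R F] [AddCommGroup J]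
    [Module R J] [Module.Finite R F] [Module.Projective R F] :
    TensorProduct R F J ≃ₗ[R] (Module.Dual R F →ₗ[R] J) :=
  (TensorProduct.congr (Module.evalEquiv R F) (LinearEquiv.refl R J)).trans
    (dualTensorHomEquiv R (Module.Dual R F) J)

variable {F₀ F₁ F₂ J : Type u} [AddCommGroup F₀] [Module R F₀] [AddCommGroup F₁] [Module R F₁]
  [AddCommGroup F₂] [Module R F₂] [AddCommGroup J] [Module R J]
  [Module.Finite R F₀] [Module.Projective R F₀] [Module.Finite R F₁] [Module.Projective R F₁]
  [Module.Finite R F₂] [Module.Projective R F₂]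

lemma tensorEquivDualHom_tmul (x : F₀) (j : J) (φ : Module.Dual R F₀) :
    tensorEquivDualHom F₀ J (x ⊗ₜ[R] j) φ = φ x • j := by
  simp [tensorEquivDualHom]

lemma tensorEquivDualHom_rTensor (a : F₁ →ₗ[R] F₀) (z : TensorProduct R F₁ J) :
    tensorEquivDualHom F₀ J (a.rTensor J z) = tensorEquivDualHom F₁ J z ∘ₗ a.dualMap := by
  induction z using TensorProduct.induction_on with
  | zero => simp
  | tmul x j =>
    ext φ
    simp [tensorEquivDualHom_tmul]
  | add x y hx hy => rw [map_add, map_add, hx, hy, map_add, LinearMap.add_comp]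

/-- Through F ⊗ J = Hom(F*, J) the claim is that Hom(-, J) preserves exactness at the dual of F₁. -/
lemma rTensor_exact_of_dualMap_exact (hJ : Module.Injective R J) (a : F₁ →ₗ[R] F₀)
    (b : F₂ →ₗ[R] F₁) (h : ∀ φ : Module.Dual R F₁, b.dualMap φ = 0 → ∃ ψ, a.dualMap ψ = φ)
    (z : TensorProduct R F₁ J) (hz : a.rTensor J z = 0) : ∃ w, b.rTensor J w = z := by
  obtain ⟨s, hs⟩ := hJ.exists_comp_eq b.dualMap (tensorEquivDualHom F₁ J z) fun φ hφ => by
    obtain ⟨ψ, rfl⟩ := h φ hφ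
    rw [← LinearMap.comp_apply, ← tensorEquivDualHom_rTensor, hz, map_zero, LinearMap.zero_apply]
  refine ⟨(tensorEquivDualHom F₂ J).symm s, (tensorEquivDualHom F₁ J).injective ?_⟩
  rw [tensorEquivDualHom_rTensor, LinearEquiv.apply_symm_apply, hs]

end DualTensor

section ExtTor

variable {R : Type u} [CommRing R] [IsNoetherianRing R]

lemma exists_finite_free_cover (X : ModuleCat.{u} R) [Module.Finite R X] :
    ∃ (K F : ModuleCat.{u} R) (f : K →ₗ[R] F) (g : F →ₗ[R] X), Module.Finite R K ∧
      Module.Finite R F ∧ Module.Free R F ∧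
      Function.Injective f ∧ Function.Surjective g ∧ Function.Exact f g := by
  obtain ⟨n, g, hg⟩ := Module.Finite.exists_fin' R X
  exact ⟨ModuleCat.of R (LinearMap.ker g), ModuleCat.of R (Fin n → R), (LinearMap.ker g).subtype, g,
    inferInstanceAs (Module.Finite R (LinearMap.ker g)),
    inferInstanceAs (Module.Finite R (Fin n → R)), inferInstanceAs (Module.Free R (Fin n → R)),
    Submodule.subtype_injective _, hg, LinearMap.exact_subtype_ker_map g⟩

/-- Tor_n(X, J) is Hom(Ext^n(X, R), J): a finite free resolution tensored with J is Hom of its dual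
into J, and Hom(-, J) is exact. Only the vanishing is extracted, by dimension shifting. -/
lemma TorVanishes.of_ext {X J : ModuleCat.{u} R} [Module.Finite R X] (hJ : Module.Injective R J)
    (n : ℕ) (h : Subsingleton (Abelian.Ext X (ModuleCat.of R R) n)) : TorVanishes n X J := by
  induction n generalizing X with
  | zero =>
    obtain ⟨K, F, f, g, hK, hF, hF', hf, hg, hfg⟩ := exists_finite_free_cover X
    obtain ⟨K', F', f', g', hK', hF1, hF1', hf', hg', hfg'⟩ := exists_finite_free_cover K
    rw [torVanishes_zero_iff]
    refine subsingleton_of_forall_eq 0 fun z => ?_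
    obtain ⟨z, rfl⟩ := g.rTensor_surjective J hg z
    -- The zero map serves as outgoing map: Hom(X, R) = 0 says that F* → F'* is injective.
    obtain ⟨w, rfl⟩ := rTensor_exact_of_dualMap_exact hJ (0 : F →ₗ[R] R) (f ∘ₗ g') (by
      intro φ hφ
      refine ⟨0, ?_⟩
      obtain ⟨c, hc⟩ := exists_comp_eq_of_ker_le hg φ (by
        intro x hx
        obtain ⟨y, rfl⟩ := (hfg x).1 hx
        obtain ⟨y, rfl⟩ := hg' y
        exact LinearMap.congr_fun hφ y)
      have : ModuleCat.ofHom c = (0 : X ⟶ ModuleCat.of R R) :=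
        (Abelian.Ext.mk₀_bijective _ _).1 (Subsingleton.elim _ _)
      have hc0 : c = 0 := congrArg ModuleCat.Hom.hom this
      rw [← hc, hc0]; simp) z (by simp)
    rw [LinearMap.rTensor_comp, LinearMap.comp_apply]
    exact (rTensor_exact J hfg hg).apply_apply_eq_zero _
  | succ n ih =>
    obtain ⟨K, F, f, g, hK, hF, hF', hf, hg, hfg⟩ := exists_finite_free_cover X
    let S : ShortComplex (ModuleCat.{u} R) :=
      ShortComplex.mk (ModuleCat.ofHom f) (ModuleCat.ofHom g)
        (ModuleCat.hom_ext (LinearMap.ext hfg.apply_apply_eq_zero))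
    have hS : S.ShortExact := ModuleCat.shortComplex_shortExact S hfg hf hg
    -- Ext^n(F, R) → Ext^n(K, R) is onto because Ext^{n+1}(X, R) = 0. For n = 0 this extends
    -- functionals from K to F; for n > 0 it gives Ext^n(K, R) = 0.
    have hext : ∀ x₁ : Abelian.Ext S.X₁ (ModuleCat.of R R) n,
        ∃ x₂ : Abelian.Ext S.X₂ (ModuleCat.of R R) n,
          (Abelian.Ext.mk₀ S.f).comp x₂ (zero_add n) = x₁ := fun x₁ =>
      Abelian.Ext.contravariant_sequence_exact₁ hS _ x₁ (add_comm 1 n) (h.elim _ _)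
    cases n with
    | zero =>
      obtain ⟨K', F', f', g', hK', hF1, hF1', hf', hg', hfg'⟩ := exists_finite_free_cover K
      obtain ⟨K'', F'', f'', g'', hK'', hF2, hF2', hf'', hg'', hfg''⟩ := exists_finite_free_cover K'
      rw [torVanishes_one_iff hf hg hfg, injective_iff_map_eq_zero]
      intro z hz
      obtain ⟨z, rfl⟩ := g'.rTensor_surjective J hg' z
      obtain ⟨w, rfl⟩ := rTensor_exact_of_dualMap_exact hJ (f ∘ₗ g') (f' ∘ₗ g'') (by
        intro φ hφ
        obtain ⟨c, hc⟩ := exists_comp_eq_of_ker_le hg' φ (by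
          intro x hx
          obtain ⟨y, rfl⟩ := (hfg' x).1 hx
          obtain ⟨y, rfl⟩ := hg'' y
          exact LinearMap.congr_fun hφ y)
        obtain ⟨x₂, hx₂⟩ := hext (Abelian.Ext.mk₀ (ModuleCat.ofHom c))
        obtain ⟨ψ, rfl⟩ := (Abelian.Ext.mk₀_bijective _ _).2 x₂
        rw [Abelian.Ext.mk₀_comp_mk₀] at hx₂
        have hψ := congrArg ModuleCat.Hom.hom ((Abelian.Ext.mk₀_bijective _ _).1 hx₂)
        refine ⟨ψ.hom, ?_⟩
        rw [← hc]
        change (ψ.hom ∘ₗ f) ∘ₗ g' = c ∘ₗ g'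
        exact congrArg (· ∘ₗ g') hψ) z (by
          rw [LinearMap.rTensor_comp, LinearMap.comp_apply, hz])
      rw [LinearMap.rTensor_comp, LinearMap.comp_apply]
      exact (rTensor_exact J hfg' hg').apply_apply_eq_zero _
    | succ n =>
      rw [torVanishes_succ_succ_iff hf hg hfg]
      refine ih (X := K) (subsingleton_of_forall_eq 0 fun x₁ => ?_)
      obtain ⟨x₂, rfl⟩ := hext x₁
      have : Projective S.X₂ :=
        (IsProjective.iff_projective F).1 (inferInstanceAs (Module.Projective R F))
      rw [Abelian.Ext.eq_zero_of_projective x₂, Abelian.Ext.comp_zero]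

end ExtTor

lemma TorVanishes.of_iso {R : Type u} [CommRing R] {n : ℕ} {X M N : ModuleCat.{u} R} (h : TorVanishes n X M)
    (e : M ≅ N) : TorVanishes n X N :=
  ((((Tor (ModuleCat.{u} R) n).obj X).mapIso e).isZero_iff).1 h

/-! ### Width of Gorenstein injective modules and the Cohen–Macaulay case -/

section Width

variable {R : Type u} [CommRing R] [IsLocalRing R]

/-- `Tor_n(k, M) = 0` for `n < d`. -/
def WidthGE (d : ℕ) (M : ModuleCat.{u} R) : Prop :=
  ∀ n < d, TorVanishes n (ModuleCat.of R (IsLocalRing.ResidueField R)) M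

lemma natCast_le_moduleWidth_iff (d : ℕ) (M : ModuleCat.{u} R) :
    (d : ℕ∞) ≤ moduleWidth M ↔ WidthGE d M := by
  simp only [moduleWidth, le_iInf_iff, WidthGE, TorVanishes, Nat.cast_le]
  exact forall_congr' fun n => ⟨fun h hn => by_contra fun hc => absurd (h hc) (not_le.2 hn),
    fun h hn => not_lt.1 fun hc => hn (h hc)⟩

lemma natCast_le_moduleDepth_iff (d : ℕ) (M : ModuleCat.{u} R) :
    (d : ℕ∞) ≤ moduleDepth M ↔
      ∀ n < d, Subsingleton
        (Abelian.Ext (ModuleCat.of R (IsLocalRing.ResidueField R)) M n) := by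
  simp only [moduleDepth, le_iInf_iff, Nat.cast_le]
  refine forall_congr' fun n => ⟨fun h hn => ?_, fun h hn => ?_⟩
  · rw [← not_nontrivial_iff_subsingleton]
    exact fun hc => absurd (h hc) (not_le.2 hn)
  · exact not_lt.1 fun hc => not_subsingleton_iff_nontrivial.2 hn (h hc)

lemma exists_not_torVanishes_of_moduleWidth_lt_top {M : ModuleCat.{u} R} (h : moduleWidth M < ⊤) :
    ∃ n, ¬ TorVanishes n (ModuleCat.of R (IsLocalRing.ResidueField R)) M := by
  by_contra hc
  push Not at hc
  refine h.ne (top_unique ?_)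
  simp only [moduleWidth, le_iInf_iff]
  exact fun n hn => absurd (hc n) hn

lemma WidthGE.of_equiv {d : ℕ} {M N : ModuleCat.{u} R} (h : WidthGE d M) (e : M ≃ₗ[R] N) :
    WidthGE d N := fun n hn => (h n hn).of_iso e.toModuleIso

lemma WidthGE.mono {c d : ℕ} {M : ModuleCat.{u} R} (h : WidthGE d M) (hcd : c ≤ d) :
    WidthGE c M := fun n hn => h n (hn.trans_le hcd)

lemma WidthGE.of_shortExact_left {A B C : ModuleCat.{u} R} {a : A →ₗ[R] B} {b : B →ₗ[R] C}
    (ha : Function.Injective a) (hb : Function.Surjective b) (hab : Function.Exact a b) {c : ℕ}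
    (hC : WidthGE (c + 1) C) (hB : WidthGE c B) : WidthGE c A := fun n hn =>
  TorVanishes.of_shortExact_left ha hb hab n _ (hC _ (by omega)) (hB n hn)

lemma torVanishes_zero_residueField_iff (M : ModuleCat.{u} R) :
    TorVanishes 0 (ModuleCat.of R (IsLocalRing.ResidueField R)) M ↔
      IsLocalRing.maximalIdeal R • (⊤ : Submodule R M) = ⊤ := by
  rw [torVanishes_zero_iff,
    ← Submodule.Quotient.subsingleton_iff]
  exact (TensorProduct.quotTensorEquivQuotSMul M
    (IsLocalRing.maximalIdeal R)).toEquiv.subsingleton_congr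

lemma WidthGE.smul_top_eq_top {M : ModuleCat.{u} R} (h : WidthGE 1 M) :
    IsLocalRing.maximalIdeal R • (⊤ : Submodule R M) = ⊤ :=
  (torVanishes_zero_residueField_iff M).1 (h 0 one_pos)

lemma moduleWidth_self_lt_top : moduleWidth (ModuleCat.of R R) < ⊤ := by
  refine lt_of_le_of_lt ?_ (ENat.natCast_lt_top 0)
  refine iInf₂_le 0 fun h => ?_
  have h1 := (torVanishes_zero_residueField_iff (ModuleCat.of R R)).1 h
  have h2 : IsLocalRing.maximalIdeal R = ⊤ := by simpa using h1
  exact Ideal.IsPrime.ne_top' h2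

/-- In 0 → K → J → N → 0 with K Gorenstein injective, Tor_{n+1}(k, N) lies between Tor_{n+1}(k, J) =
0 and Tor_n(k, K), so induction on n applies to all N at once. -/
lemma IsGorensteinInjective.widthGE [IsNoetherianRing R] {d : ℕ}
    (hd : (d : ℕ∞) ≤ moduleDepth (ModuleCat.of R R)) {N : ModuleCat.{u} R}
    (hN : IsGorensteinInjective N) : WidthGE d N := by
  rw [natCast_le_moduleDepth_iff] at hd
  have hfin : Module.Finite R (ModuleCat.of R (IsLocalRing.ResidueField R)) :=
    inferInstanceAs (Module.Finite R (IsLocalRing.ResidueField R))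
  have hJ : ∀ J : ModuleCat.{u} R, Module.Injective R J → WidthGE d J := fun J hJ n hn =>
    TorVanishes.of_ext hJ n (hd n hn)
  intro n hn
  induction n generalizing N with
  | zero =>
    obtain ⟨K, -, J, f, g, hs⟩ := hN.exists_left
    have h1 := hJ J hs.injective_mid 0 hn
    rw [torVanishes_zero_iff] at h1 ⊢
    exact (g.lTensor_surjective _ hs.g_surjective).subsingleton
  | succ n ih =>
    obtain ⟨K, hK, J, f, g, hs⟩ := hN.exists_left
    exact TorVanishes.of_shortExact_right hs.f_injective hs.g_surjective hs.exact n _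
      (hJ J hs.injective_mid _ hn) (ih hK (by omega))

lemma IsCohenMacaulayLocalRing.exists_width [IsNoetherianRing R] (h : IsCohenMacaulayLocalRing R) :
    ∃ B : ModuleCat.{u} R, moduleWidth B < ⊤ ∧ ∀ N : ModuleCat.{u} R, IsGorensteinInjective N →
      ringKrullDim R ≤ ((moduleWidth (ModuleCat.of R (B →ₗ[R] N)) : ℕ∞) : WithBot ℕ∞) := by
  refine ⟨ModuleCat.of R R, moduleWidth_self_lt_top, fun N hN => ?_⟩
  rw [← h, WithBot.coe_le_coe]
  refine ENat.forall_natCast_le_iff_le.1 fun d hd => ?_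
  rw [natCast_le_moduleWidth_iff]
  exact (hN.widthGE hd).of_equiv (LinearMap.ringLmapEquivSelf R R N).symm

end Width

/-! ### Derived completeness and Nakayama's lemma -/

section DerivedComplete

variable {R : Type u} [CommRing R] {M N P : Type u} [AddCommGroup M] [Module R M]
  [AddCommGroup N] [Module R N] [AddCommGroup P] [Module R P]

/-- The endomorphism `(y_i) ↦ (y_i - θ y_{i+1})` of the module of sequences in `M`. -/
def telescope (θ : M →ₗ[R] M) : (ℕ → M) →ₗ[R] (ℕ → M) where
  toFun y i := y i - θ (y (i + 1))
  map_add' y z := by ext i; simp only [Pi.add_apply, map_add]; abel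
  map_smul' r y := by ext i; simp [smul_sub]

@[simp]
lemma telescope_apply (θ : M →ₗ[R] M) (y : ℕ → M) (i : ℕ) :
    telescope θ y i = y i - θ (y (i + 1)) := rfl

lemma telescope_comp {θ : M →ₗ[R] M} {η : N →ₗ[R] N} {f : M →ₗ[R] N}
    (h : ∀ x, f (θ x) = η (f x)) (y : ℕ → M) : telescope η (f ∘ y) = f ∘ telescope θ y := by
  ext i
  simp [h]

lemma exists_seq_of_forall_exists {f : M →ₗ[R] N} {b : ℕ → N} (h : ∀ i, ∃ a, f a = b i) :
    ∃ a : ℕ → M, f ∘ a = b := by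
  choose a ha using h
  exact ⟨a, funext ha⟩

/-- A module with an endomorphism `θ` is derived complete along `θ` if all `Ext` groups from the
localization of the polynomial ring at its variable vanish; concretely, if `telescope θ` is
bijective. -/
def IsTelescopic (θ : M →ₗ[R] M) : Prop := Function.Bijective (telescope θ)

/-- Forming sequences is exact, so this is a chase; `f` need not be injective. -/
lemma IsTelescopic.of_cokernel {θ : M →ₗ[R] M} {η : N →ₗ[R] N} {ζ : P →ₗ[R] P} {f : M →ₗ[R] N}
    {g : N →ₗ[R] P} (hg : Function.Surjective g) (hfg : Function.Exact f g)
    (hθ : ∀ x, f (θ x) = η (f x)) (hη : ∀ x, g (η x) = ζ (g x))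
    (h₁ : IsTelescopic θ) (h₂ : IsTelescopic η) : IsTelescopic ζ := by
  constructor
  · rw [injective_iff_map_eq_zero]
    intro y hy
    obtain ⟨z, rfl⟩ := exists_seq_of_forall_exists fun i => hg (y i)
    rw [telescope_comp hη] at hy
    obtain ⟨w, hw⟩ := exists_seq_of_forall_exists fun i => (hfg _).1 (congrFun hy i)
    obtain ⟨w, rfl⟩ := h₁.2 w
    rw [← telescope_comp hθ] at hw
    rw [← h₂.1 hw]
    ext i
    simp [hfg.apply_apply_eq_zero]
  · intro y
    obtain ⟨z, rfl⟩ := exists_seq_of_forall_exists fun i => hg (y i)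
    obtain ⟨w, rfl⟩ := h₂.2 z
    exact ⟨g ∘ w, telescope_comp hη w⟩

variable (M) in
/-- A module is derived complete along `x`. -/
def DerivedComplete (x : R) : Prop := IsTelescopic (LinearMap.lsmul R M x)

lemma DerivedComplete.of_equiv {x : R} (h : DerivedComplete M x) (e : M ≃ₗ[R] N) :
    DerivedComplete N x :=
  IsTelescopic.of_cokernel (f := (0 : M →ₗ[R] M)) (g := e.toLinearMap) (θ := LinearMap.lsmul R M x)
    (η := LinearMap.lsmul R M x) e.surjective (fun y => by simpa using eq_comm)
    (by simp) (by simp) h h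

lemma DerivedComplete.pi {x : R} (h : DerivedComplete M x) : DerivedComplete (ℕ → M) x := by
  constructor
  · rw [injective_iff_map_eq_zero]
    intro y hy
    have h1 : ∀ j, (fun i => y i j) = 0 := fun j => h.1 (by
      rw [map_zero]
      ext i
      exact congrFun (congrFun hy i) j)
    ext i j
    exact congrFun (h1 j) i
  · intro y
    choose z hz using fun j => h.2 fun i => y i j
    refine ⟨fun i j => z j i, ?_⟩
    ext i j
    exact congrFun (hz j) i

/-- Dividing `m` by `x` again and again produces a sequence in the kernel of the telescope map, with
`m` as its first entry. -/
lemma DerivedComplete.subsingleton {x : R} (h : DerivedComplete M x)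
    (hx : ∀ m : M, ∃ m', x • m' = m) : Subsingleton M := by
  refine subsingleton_of_forall_eq 0 fun m => ?_
  choose g hg using hx
  have h1 : (fun i => g^[i] m) = 0 := h.1 (by
    rw [map_zero]
    ext i
    simp [Function.iterate_succ_apply', hg])
  exact congrFun h1 0

lemma DerivedComplete.quotient {x : R} (h : DerivedComplete M x) (y : R) :
    DerivedComplete (M ⧸ LinearMap.range (LinearMap.lsmul R M y)) x :=
  IsTelescopic.of_cokernel (f := LinearMap.lsmul R M y) (Submodule.mkQ_surjective _)
    (LinearMap.exact_map_mkQ_range _) (fun m => smul_comm _ _ _) (by simp) h h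

/-- Nakayama's lemma for derived complete modules. -/
lemma subsingleton_of_derivedComplete (l : List R) (h : ∀ x ∈ l, DerivedComplete M x)
    (hl : Ideal.span {x | x ∈ l} • (⊤ : Submodule R M) = ⊤) : Subsingleton M := by
  induction l generalizing M with
  | nil =>
    rw [← Submodule.subsingleton_iff R]
    exact subsingleton_of_bot_eq_top (by simpa using hl)
  | cons x l ih =>
    -- M/xM is still derived complete along the remaining elements, so by induction it vanishes.
    -- Then M = xM, and completeness along `x` finishes.
    have h1 : Subsingleton (M ⧸ LinearMap.range (LinearMap.lsmul R M x)) := by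
      refine ih (fun y hy => (h y (List.mem_cons_of_mem _ hy)).quotient x) ?_
      have h2 := congrArg (Submodule.map (LinearMap.range (LinearMap.lsmul R M x)).mkQ) hl
      rw [Submodule.map_smul'', Submodule.map_top, Submodule.range_mkQ] at h2
      refine top_unique (h2.symm.le.trans (Submodule.smul_le.2 ?_))
      intro r hr n _
      have h3 : {y | y ∈ x :: l} = insert x {y | y ∈ l} := by ext; simp
      rw [h3, Ideal.mem_span_insert] at hr
      obtain ⟨a, z, hz, rfl⟩ := hr
      obtain ⟨m, rfl⟩ := Submodule.mkQ_surjective _ n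
      rw [add_smul]
      refine Submodule.add_mem _ ?_ (Submodule.smul_mem_smul hz Submodule.mem_top)
      have h4 : (LinearMap.range (LinearMap.lsmul R M x)).mkQ (x • m) = 0 :=
        (Submodule.Quotient.mk_eq_zero _).2 ⟨m, rfl⟩
      rw [mul_smul, ← map_smul, h4, smul_zero]
      exact Submodule.zero_mem _
    refine (h x List.mem_cons_self).subsingleton fun m => ?_
    have := (Submodule.Quotient.mk_eq_zero (LinearMap.range (LinearMap.lsmul R M x))).1
      (Subsingleton.elim (Submodule.Quotient.mk m) 0)
    exact this

end DerivedComplete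

/-! ### Derived completion of modules, exact on finite modules -/

section Completion

variable {R : Type u} [CommRing R] {M N P : Type u} [AddCommGroup M] [Module R M]
  [AddCommGroup N] [Module R N] [AddCommGroup P] [Module R P]

variable (R M) in
/-- The right shift on sequences. -/
def seqShift : (ℕ → M) →ₗ[R] (ℕ → M) where
  toFun a := fun
    | 0 => 0
    | i + 1 => a i
  map_add' a b := by ext (_ | i) <;> simp
  map_smul' r a := by ext (_ | i) <;> simp

@[simp]
lemma seqShift_zero (a : ℕ → M) : seqShift R M a 0 = 0 := rfl

@[simp]
lemma seqShift_succ (a : ℕ → M) (i : ℕ) : seqShift R M a (i + 1) = a i := rfl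

lemma seqShift_comp (f : M →ₗ[R] N) (a : ℕ → M) : seqShift R N (f ∘ a) = f ∘ seqShift R M a := by
  ext (_ | i) <;> simp

/-- Power series are X-adically complete: the n-th coefficient of `y i` is determined by the target
and the (n-1)-st coefficient of `y (i + 1)`. -/
lemma isTelescopic_seqShift : IsTelescopic (seqShift R M) := by
  constructor
  · rw [injective_iff_map_eq_zero]
    intro y hy
    have h : ∀ n i, y i n = 0 := fun n => by
      induction n with
      | zero =>
        intro i
        simpa using congrFun (congrFun hy i) 0
      | succ n ih =>
        intro i
        simpa [ih] using congrFun (congrFun hy i) (n + 1)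
    ext i n
    exact h n i
  · intro y
    let z : ℕ → ℕ → M := fun n => Nat.rec (fun i => y i 0) (fun n w i => y i (n + 1) + w (i + 1)) n
    refine ⟨fun i n => z n i, ?_⟩
    ext i (_ | n)
    · simp [z]
    · simp [z]

variable (M) in
/-- Multiplication by `X - x` on power series with coefficients in `M`. -/
def shiftSub (x : R) : (ℕ → M) →ₗ[R] (ℕ → M) := seqShift R M - LinearMap.lsmul R (ℕ → M) x

lemma shiftSub_apply (x : R) (a : ℕ → M) : shiftSub M x a = seqShift R M a - x • a := rfl

lemma shiftSub_comp (x : R) (f : M →ₗ[R] N) (a : ℕ → M) :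
    shiftSub N x (f ∘ a) = f ∘ shiftSub M x a := by
  rw [shiftSub_apply, seqShift_comp]
  ext i
  simp [shiftSub_apply]

/-- The kernel of X - x, the first derived completion, is the inverse limit of the x-power torsion.
-/
lemma eq_smul_of_shiftSub_eq_zero {x : R} {a : ℕ → M} (h : shiftSub M x a = 0) :
    x • a 0 = 0 ∧ ∀ i, x • a (i + 1) = a i := by
  rw [shiftSub_apply, sub_eq_zero] at h
  exact ⟨(congrFun h 0).symm, fun i => (congrFun h (i + 1)).symm⟩

lemma shiftSub_injective_of_smul_eq_zero {x : R} (h : ∀ m : M, x • m = 0) :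
    Function.Injective (shiftSub M x) := by
  rw [injective_iff_map_eq_zero]
  intro a ha
  ext i
  rw [← (eq_smul_of_shiftSub_eq_zero ha).2, h, Pi.zero_apply]

section ShortExact

variable {f : M →ₗ[R] N} {g : N →ₗ[R] P}

lemma shiftSub_injective_of_exact (hf : Function.Injective f) (hfg : Function.Exact f g) {x : R}
    (hM : Function.Injective (shiftSub M x)) (hP : Function.Injective (shiftSub P x)) :
    Function.Injective (shiftSub N x) := by
  rw [injective_iff_map_eq_zero]
  intro a ha
  have h : g ∘ a = 0 := hP (by rw [shiftSub_comp, ha, map_zero]; ext; simp)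
  obtain ⟨b, rfl⟩ := exists_seq_of_forall_exists fun i => (hfg (a i)).1 (congrFun h i)
  have hb : b = 0 := hM (by
    rw [shiftSub_comp] at ha
    rw [map_zero]
    ext i
    exact hf ((congrFun ha i).trans (by simp)))
  rw [hb]
  ext
  simp

/-- Kernel elements are divisible by `x` inside the kernel, where multiplication by `x` shifts
coefficients to the right and inserts 0. Iterating, all coefficients vanish. -/
lemma shiftSub_injective_of_smul_injective {x : R} (hf : ∀ m : M, x • m = 0 → m = 0)
    {g : M →ₗ[R] P} (hfg : Function.Exact (LinearMap.lsmul R M x) g)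
    (hP : Function.Injective (shiftSub P x)) : Function.Injective (shiftSub M x) := by
  rw [injective_iff_map_eq_zero]
  have key : ∀ a : ℕ → M, shiftSub M x a = 0 → ∃ b, shiftSub M x b = 0 ∧ x • b = a := by
    intro a ha
    have h : g ∘ a = 0 := hP (by rw [shiftSub_comp, ha, map_zero]; ext; simp)
    obtain ⟨b, rfl⟩ := exists_seq_of_forall_exists fun i => (hfg (a i)).1 (congrFun h i)
    refine ⟨b, ?_, rfl⟩
    rw [shiftSub_comp] at ha
    ext i
    exact hf _ (congrFun ha i)
  have h : ∀ i (a : ℕ → M), shiftSub M x a = 0 → a i = 0 := fun i => by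
    induction i with
    | zero =>
      intro a ha
      obtain ⟨b, hb, rfl⟩ := key a ha
      exact (eq_smul_of_shiftSub_eq_zero hb).1
    | succ i ih =>
      intro a ha
      obtain ⟨b, hb, rfl⟩ := key a ha
      exact ((eq_smul_of_shiftSub_eq_zero hb).2 i).trans (ih b hb)
  intro a ha
  ext i
  exact h i a ha

end ShortExact

variable (M) in
/-- The zeroth derived completion of `M` along `x`. -/
abbrev LZero (x : R) : Type u := (ℕ → M) ⧸ LinearMap.range (shiftSub M x)

/-- Functoriality of `LZero`. -/
def LZero.map (x : R) (f : M →ₗ[R] N) : LZero M x →ₗ[R] LZero N x :=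
  Submodule.mapQ _ _ (f.compLeft ℕ) (by
    rintro _ ⟨a, rfl⟩
    exact ⟨f ∘ a, shiftSub_comp x f a⟩)

lemma LZero.map_mk (x : R) (f : M →ₗ[R] N) (a : ℕ → M) :
    LZero.map x f (Submodule.Quotient.mk a) = Submodule.Quotient.mk (f ∘ a) := rfl

lemma LZero.map_surjective (x : R) {f : M →ₗ[R] N} (hf : Function.Surjective f) :
    Function.Surjective (LZero.map x f) := by
  intro b
  obtain ⟨b, rfl⟩ := Submodule.Quotient.mk_surjective _ b
  obtain ⟨a, rfl⟩ := exists_seq_of_forall_exists fun i => hf (b i)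
  exact ⟨Submodule.Quotient.mk a, rfl⟩

lemma LZero.map_exact (x : R) {f : M →ₗ[R] N} {g : N →ₗ[R] P} (hfg : Function.Exact f g)
    (hg : Function.Surjective g) : Function.Exact (LZero.map x f) (LZero.map x g) := by
  intro b
  constructor
  · obtain ⟨b, rfl⟩ := Submodule.Quotient.mk_surjective _ b
    rw [LZero.map_mk, Submodule.Quotient.mk_eq_zero]
    rintro ⟨c, hc⟩
    obtain ⟨b', rfl⟩ := exists_seq_of_forall_exists fun i => hg (c i)
    rw [shiftSub_comp] at hc
    obtain ⟨a, ha⟩ := exists_seq_of_forall_exists (f := f) (b := b - shiftSub N x b') fun i =>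
      (hfg _).1 (by
        rw [Pi.sub_apply, map_sub, sub_eq_zero]
        exact (congrFun hc i).symm)
    refine ⟨Submodule.Quotient.mk a, ?_⟩
    rw [LZero.map_mk, ha, Submodule.Quotient.eq]
    exact ⟨-b', by rw [map_neg]; abel⟩
  · rintro ⟨a, rfl⟩
    obtain ⟨a, rfl⟩ := Submodule.Quotient.mk_surjective _ a
    rw [LZero.map_mk, LZero.map_mk, Submodule.Quotient.mk_eq_zero]
    refine ⟨0, ?_⟩
    rw [map_zero]
    ext i
    exact (hfg.apply_apply_eq_zero _).symm

lemma LZero.map_injective (x : R) {f : M →ₗ[R] N} {g : N →ₗ[R] P} (hf : Function.Injective f)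
    (hfg : Function.Exact f g) (hP : Function.Injective (shiftSub P x)) :
    Function.Injective (LZero.map x f) := by
  rw [injective_iff_map_eq_zero]
  intro a
  obtain ⟨a, rfl⟩ := Submodule.Quotient.mk_surjective _ a
  rw [LZero.map_mk, Submodule.Quotient.mk_eq_zero, Submodule.Quotient.mk_eq_zero]
  rintro ⟨b, hb⟩
  have h : g ∘ b = 0 := hP (by
    rw [shiftSub_comp, hb, map_zero]
    ext i
    exact hfg.apply_apply_eq_zero _)
  obtain ⟨a', rfl⟩ := exists_seq_of_forall_exists fun i => (hfg (b i)).1 (congrFun h i)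
  refine ⟨a', ?_⟩
  rw [shiftSub_comp] at hb
  ext i
  exact hf (congrFun hb i)

lemma LZero.map_lsmul (x r : R) :
    LZero.map x (LinearMap.lsmul R M r) = LinearMap.lsmul R (LZero M x) r := by
  ext a
  rfl

/-- On the cokernel of X - x, multiplication by `x` is the shift, which is telescopic on power
series. -/
lemma derivedComplete_lZero (x : R) : DerivedComplete (LZero M x) x := by
  refine IsTelescopic.of_cokernel (f := shiftSub M x) (θ := seqShift R M) (η := seqShift R M)
    (Submodule.mkQ_surjective _) (LinearMap.exact_map_mkQ_range _) ?_ ?_ isTelescopic_seqShift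
    isTelescopic_seqShift
  · intro a
    simp [shiftSub_apply]
  · intro a
    rw [LinearMap.lsmul_apply, ← map_smul, Submodule.mkQ_apply, Submodule.mkQ_apply,
      Submodule.Quotient.eq]
    exact ⟨a, rfl⟩

lemma DerivedComplete.lZero {y : R} (h : DerivedComplete M y) (x : R) :
    DerivedComplete (LZero M x) y :=
  IsTelescopic.of_cokernel (f := shiftSub M x) (Submodule.mkQ_surjective _)
    (LinearMap.exact_map_mkQ_range _) (by simp) (by simp) h.pi h.pi

/-- A map to a module killed by `x` extends to `LZero`. -/
lemma LZero.exists_surjective {x : R} {q : M →ₗ[R] N} (hq : Function.Surjective q)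
    (hx : ∀ n : N, x • n = 0) : ∃ q' : LZero M x →ₗ[R] N, Function.Surjective q' := by
  -- The constant coefficient of (X - x)a is -x a₀, which dies in a module killed by `x`.
  refine ⟨Submodule.liftQ _ (q ∘ₗ LinearMap.proj 0) ?_, ?_⟩
  · rintro _ ⟨a, rfl⟩
    simp [shiftSub_apply, hx]
  · intro n
    obtain ⟨m, rfl⟩ := hq n
    exact ⟨Submodule.Quotient.mk fun _ => m, rfl⟩

/-- Iterated derived completion along a list of ring elements. -/
def completion (M : ModuleCat.{u} R) : List R → ModuleCat.{u} R
  | [] => M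
  | x :: l => ModuleCat.of R (LZero (completion M l) x)

/-- Functoriality of `completion`. -/
def completionMap {M N : ModuleCat.{u} R} (f : M →ₗ[R] N) :
    ∀ l : List R, completion M l →ₗ[R] completion N l
  | [] => f
  | x :: l => LZero.map x (completionMap f l)

lemma completionMap_lsmul (M : ModuleCat.{u} R) (r : R) (l : List R) :
    completionMap (LinearMap.lsmul R M r) l = LinearMap.lsmul R (completion M l) r := by
  induction l with
  | nil => rfl
  | cons x l ih =>
    rw [completionMap, ih]
    exact LZero.map_lsmul x r

lemma derivedComplete_completion (M : ModuleCat.{u} R) (l : List R) {x : R} (hx : x ∈ l) :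
    DerivedComplete (completion M l) x := by
  induction l with
  | nil => simp at hx
  | cons y l ih =>
    rcases List.mem_cons.1 hx with rfl | h
    · exact derivedComplete_lZero x
    · exact (ih h).lZero y

/-- With N = M/mM this shows that the completion of a nonzero finite module is nonzero. -/
lemma exists_surjective_completion {M N : ModuleCat.{u} R} {q : M →ₗ[R] N}
    (hq : Function.Surjective q) (l : List R) (hl : ∀ x ∈ l, ∀ n : N, x • n = 0) :
    ∃ q' : completion M l →ₗ[R] N, Function.Surjective q' := by
  induction l with
  | nil => exact ⟨q, hq⟩
  | cons x l ih =>
    obtain ⟨q', hq'⟩ := ih fun y hy => hl y (List.mem_cons_of_mem _ hy)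
    exact LZero.exists_surjective hq' (hl x List.mem_cons_self)

lemma completion_smul_eq_zero {A : ModuleCat.{u} R} {x : R} (h : ∀ a : A, x • a = 0) (l : List R)
    (a : completion A l) : x • a = 0 := by
  induction l with
  | nil => exact h a
  | cons y l ih =>
    obtain ⟨a, rfl⟩ := Submodule.Quotient.mk_surjective _ a
    exact congrArg Submodule.Quotient.mk (show x • a = 0 from funext fun i => ih (a i))

section Devissage

variable [IsNoetherianRing R]

/-- A property of finite modules that is closed under extensions holds for all of them if it holds
for those killed by `x` and for those on which `x` is injective. -/
lemma devissage_smul (x : R) (Q : ModuleCat.{u} R → Prop)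
    (hext : ∀ (A B C : ModuleCat.{u} R) (f : A →ₗ[R] B) (g : B →ₗ[R] C), Module.Finite R A →
      Module.Finite R B → Module.Finite R C → Function.Injective f → Function.Surjective g →
      Function.Exact f g → Q A → Q C → Q B)
    (hzero : ∀ A : ModuleCat.{u} R, Module.Finite R A → (∀ a : A, x • a = 0) → Q A)
    (hinj : ∀ A : ModuleCat.{u} R, Module.Finite R A → (∀ a : A, x • a = 0 → a = 0) → Q A)
    (A : ModuleCat.{u} R) (hA : Module.Finite R A) : Q A := by
  have hquot : ∀ (A : ModuleCat.{u} R) (S : Submodule R A), Module.Finite R A →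
      Q (ModuleCat.of R S) → Q (ModuleCat.of R (A ⧸ S)) → Q A := fun A S hA h₁ h₂ =>
    hext (ModuleCat.of R S) A (ModuleCat.of R (A ⧸ S)) S.subtype S.mkQ
      (inferInstanceAs (Module.Finite R S)) hA (inferInstanceAs (Module.Finite R (A ⧸ S)))
      S.subtype_injective S.mkQ_surjective (LinearMap.exact_subtype_mkQ S) h₁ h₂
  have hpow : ∀ (k : ℕ) (A : ModuleCat.{u} R), Module.Finite R A → (∀ a : A, x ^ k • a = 0) →
      Q A := fun k => by
    induction k with
    | zero =>
      refine fun A hA h => hzero A hA fun a => ?_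
      rw [show a = 0 by simpa using h a, smul_zero]
    | succ k ih =>
      intro A hA h
      refine hquot A (LinearMap.range (LinearMap.lsmul R A x)) hA (ih _ ?_ ?_) (hzero _ ?_ ?_)
      · exact inferInstanceAs (Module.Finite R (LinearMap.range (LinearMap.lsmul R A x)))
      · rintro ⟨_, a, rfl⟩
        refine Subtype.ext ?_
        change x ^ k • x • a = 0
        rw [smul_smul, ← pow_succ, h]
      · exact inferInstanceAs (Module.Finite R (A ⧸ LinearMap.range (LinearMap.lsmul R A x)))
      · intro a
        obtain ⟨a, rfl⟩ := Submodule.Quotient.mk_surjective _ a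
        exact (Submodule.Quotient.mk_eq_zero _).2 ⟨a, rfl⟩
  have hnoeth : IsNoetherian R A := isNoetherian_of_isNoetherianRing_of_finite R A
  -- Once the kernels of the powers of `x` are stationary at `k`, `x` is injective on x^k A, while
  -- A/x^k A is filtered by modules killed by `x`.
  obtain ⟨k, hk⟩ := monotone_stabilizes_iff_noetherian.2 hnoeth
    ⟨fun k => LinearMap.ker (LinearMap.lsmul R A (x ^ k)), monotone_nat_of_le_succ fun k a ha => by
      rw [LinearMap.mem_ker, LinearMap.lsmul_apply] at ha ⊢
      rw [pow_succ', mul_smul, ha, smul_zero]⟩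
  refine hquot A (LinearMap.range (LinearMap.lsmul R A (x ^ k))) hA (hinj _ ?_ ?_) (hpow k _ ?_ ?_)
  · exact inferInstanceAs (Module.Finite R (LinearMap.range (LinearMap.lsmul R A (x ^ k))))
  · rintro ⟨_, a, rfl⟩ ha
    have ha' : x • x ^ k • a = 0 := congrArg Subtype.val ha
    rw [smul_smul, ← pow_succ'] at ha'
    exact Subtype.ext ((hk (k + 1) (by omega)).symm.le ha')
  · exact inferInstanceAs (Module.Finite R (A ⧸ LinearMap.range (LinearMap.lsmul R A (x ^ k))))
  · intro a
    obtain ⟨a, rfl⟩ := Submodule.Quotient.mk_surjective _ a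
    exact (Submodule.Quotient.mk_eq_zero _).2 ⟨a, rfl⟩

end Devissage

section Finite

variable [IsNoetherianRing R]

/-- `completion` is exact on short exact sequences with finite quotient. -/
def CompletionExact (l : List R) : Prop :=
  ∀ (A B C : ModuleCat.{u} R) (f : A →ₗ[R] B) (g : B →ₗ[R] C), Module.Finite R C →
    Function.Injective f → Function.Surjective g → Function.Exact f g →
    Function.Injective (completionMap f l) ∧ Function.Surjective (completionMap g l) ∧
      Function.Exact (completionMap f l) (completionMap g l)

/-- Exactness along `l` makes the property stable under extensions, so dévissage leaves the cases
where `x` kills A or is injective on A. -/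
lemma CompletionExact.shiftSub_injective {l : List R} (H : CompletionExact l) (x : R)
    (A : ModuleCat.{u} R) (hA : Module.Finite R A) :
    Function.Injective (shiftSub (completion A l) x) := by
  refine devissage_smul x (fun A => Function.Injective (shiftSub (completion A l) x)) ?_ ?_ ?_
    A hA
  · intro A B C f g _ _ hC hf hg hfg h₁ h₂
    obtain ⟨hf', -, hfg'⟩ := H A B C f g hC hf hg hfg
    exact shiftSub_injective_of_exact hf' hfg' h₁ h₂
  · intro A _ h
    exact shiftSub_injective_of_smul_eq_zero (completion_smul_eq_zero h l)
  · intro A hA h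
    obtain ⟨h₁, -, h₃⟩ := H A A
      (ModuleCat.of R (A ⧸ LinearMap.range (LinearMap.lsmul R A x))) (LinearMap.lsmul R A x)
      (LinearMap.range (LinearMap.lsmul R A x)).mkQ
      (inferInstanceAs (Module.Finite R (A ⧸ LinearMap.range (LinearMap.lsmul R A x))))
      ((injective_iff_map_eq_zero _).2 h) (Submodule.mkQ_surjective _)
      (LinearMap.exact_map_mkQ_range _)
    rw [completionMap_lsmul] at h₁ h₃
    refine shiftSub_injective_of_smul_injective ((injective_iff_map_eq_zero _).1 h₁) h₃ ?_
    refine shiftSub_injective_of_smul_eq_zero (completion_smul_eq_zero ?_ l)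
    intro a
    obtain ⟨a, rfl⟩ := Submodule.Quotient.mk_surjective _ a
    exact (Submodule.Quotient.mk_eq_zero _).2 ⟨a, rfl⟩

/-- The obstruction to exactness at the next element is the kernel of X - x on the completed
quotient; this is why only `C` has to be finite. -/
lemma completionExact (l : List R) : CompletionExact l := by
  induction l with
  | nil => exact fun A B C f g _ hf hg hfg => ⟨hf, hg, hfg⟩
  | cons y l ih =>
    intro A B C f g hC hf hg hfg
    obtain ⟨h₁, h₂, h₃⟩ := ih A B C f g hC hf hg hfg
    exact ⟨LZero.map_injective y h₁ h₃ (ih.shiftSub_injective y C hC), LZero.map_surjective y h₂,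
      LZero.map_exact y h₃ h₂⟩

/-- Finite modules have no higher derived completions. -/
lemma shiftSub_completion_injective (l : List R) (x : R) (A : ModuleCat.{u} R)
    [hA : Module.Finite R A] : Function.Injective (shiftSub (completion A l) x) :=
  (completionExact l).shiftSub_injective x A hA

end Finite

end Completion

/-! ### Cochain sequences, cones and their derived completion -/

lemma nonempty_linearEquiv_of_ker_eq {R W A B : Type u} [CommRing R] [AddCommGroup W] [Module R W]
    [AddCommGroup A] [Module R A] [AddCommGroup B] [Module R B] {p : W →ₗ[R] A} {q : W →ₗ[R] B}
    (hp : Function.Surjective p) (hq : Function.Surjective q) (h : ∀ w, p w = 0 ↔ q w = 0) :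
    Nonempty (A ≃ₗ[R] B) :=
  ⟨(p.quotKerEquivOfSurjective hp).symm.trans ((Submodule.quotEquivOfEq _ _ (by
    ext w; exact h w)).trans (q.quotKerEquivOfSurjective hq))⟩

/-- A sequence of modules and maps, indexed by the natural numbers, with vanishing composites. -/
structure CochainSeq (R : Type u) [CommRing R] where
  /-- The terms. -/
  X : ℕ → ModuleCat.{u} R
  /-- The differentials. -/
  d : ∀ n, X n →ₗ[R] X (n + 1)
  d_d : ∀ n x, d (n + 1) (d n x) = 0

namespace CochainSeq

variable {R : Type u} [CommRing R] (C : CochainSeq R)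

/-- Cohomology at the term of index `n + 1`. -/
abbrev H (n : ℕ) : Type u :=
  LinearMap.ker (C.d (n + 1)) ⧸ (LinearMap.range (C.d n)).submoduleOf (LinearMap.ker (C.d (n + 1)))

variable {C}

/-- The class of a cocycle. -/
def toH {n : ℕ} : LinearMap.ker (C.d (n + 1)) →ₗ[R] C.H n := Submodule.mkQ _

lemma toH_surjective {n : ℕ} : Function.Surjective (toH (C := C) (n := n)) :=
  Submodule.mkQ_surjective _

lemma toH_eq_zero_iff {n : ℕ} (z : LinearMap.ker (C.d (n + 1))) :
    toH z = 0 ↔ ∃ y, C.d n y = z := by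
  rw [toH, Submodule.mkQ_apply, Submodule.Quotient.mk_eq_zero]
  rfl

lemma subsingleton_H_iff {n : ℕ} :
    Subsingleton (C.H n) ↔ ∀ x : C.X (n + 1), C.d (n + 1) x = 0 → ∃ y, C.d n y = x := by
  constructor
  · intro h x hx
    exact (toH_eq_zero_iff ⟨x, hx⟩).1 (Subsingleton.elim _ _)
  · intro h
    refine subsingleton_of_forall_eq 0 fun a => ?_
    obtain ⟨z, rfl⟩ := toH_surjective a
    exact (toH_eq_zero_iff z).2 (h z z.2)

variable (C) in
/-- The mapping cone of an endomorphism of the sequence of countable powers of `C`. -/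
def cone (φ : ∀ n, (ℕ → C.X n) →ₗ[R] (ℕ → C.X n))
    (hφ : ∀ n a, φ (n + 1) (C.d n ∘ a) = C.d n ∘ φ n a) : CochainSeq R where
  X n := ModuleCat.of R ((ℕ → C.X (n + 1)) × (ℕ → C.X n))
  d n := LinearMap.prod ((C.d (n + 1)).compLeft ℕ ∘ₗ LinearMap.fst R _ _)
    (φ (n + 1) ∘ₗ LinearMap.fst R _ _ - (C.d n).compLeft ℕ ∘ₗ LinearMap.snd R _ _)
  d_d n x := by
    refine Prod.ext ?_ ?_
    · ext i
      exact C.d_d _ _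
    · change φ (n + 2) (C.d (n + 1) ∘ x.1) - C.d (n + 1) ∘ (φ (n + 1) x.1 - C.d n ∘ x.2) = 0
      rw [hφ]
      ext i
      simp [C.d_d]

section ConeApply

variable {φ : ∀ n, (ℕ → C.X n) →ₗ[R] (ℕ → C.X n)}
    {hφ : ∀ n a, φ (n + 1) (C.d n ∘ a) = C.d n ∘ φ n a}

lemma cone_d_apply (n : ℕ) (a : ℕ → C.X (n + 1)) (b : ℕ → C.X n) :
    (C.cone φ hφ).d n (a, b) = (C.d (n + 1) ∘ a, φ (n + 1) a - C.d n ∘ b) := rfl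

lemma cone_d_eq_zero_iff (n : ℕ) (a : ℕ → C.X (n + 1)) (b : ℕ → C.X n) :
    (C.cone φ hφ).d n (a, b) = 0 ↔ C.d (n + 1) ∘ a = 0 ∧ φ (n + 1) a = C.d n ∘ b := by
  rw [cone_d_apply, ← sub_eq_zero (b := C.d n ∘ b)]
  exact Prod.mk_eq_zero

end ConeApply

variable (C) in
/-- The derived completion of `C` along `x`. -/
def complete (x : R) : CochainSeq R :=
  C.cone (fun n => shiftSub (C.X n) x) fun _ _ => shiftSub_comp x _ _

/-- The cohomology of the cone is an extension of the kernel of X - x on `C.H (n + 1)` by its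
cokernel on `C.H n`; the hypothesis removes the kernel. Both sides are compared as quotients of the
sequences of cocycles. -/
lemma nonempty_complete_H_equiv (x : R) (n : ℕ)
    (h : Function.Injective (shiftSub (C.H (n + 1)) x)) :
    Nonempty ((C.complete x).H n ≃ₗ[R] LZero (C.H n) x) := by
  let Z := LinearMap.ker (C.d (n + 1))
  let p₀ : (ℕ → Z) →ₗ[R] LinearMap.ker ((C.complete x).d (n + 1)) :=
    LinearMap.codRestrict _ (LinearMap.inr R (ℕ → C.X (n + 2)) (ℕ → C.X (n + 1)) ∘ₗ
      Z.subtype.compLeft ℕ) fun b => by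
        refine (cone_d_eq_zero_iff (n + 1) (0 : ℕ → C.X (n + 2)) (Z.subtype ∘ b)).2 ⟨?_, ?_⟩
        · ext i; simp
        · rw [map_zero]
          ext i
          exact (b i).2.symm
  let q : (ℕ → Z) →ₗ[R] LZero (C.H n) x := Submodule.mkQ _ ∘ₗ toH.compLeft ℕ
  refine nonempty_linearEquiv_of_ker_eq (p := toH ∘ₗ p₀) (q := q) ?_ ?_ ?_
  · intro c
    obtain ⟨⟨⟨a, b⟩, hc⟩, rfl⟩ := toH_surjective c
    obtain ⟨ha, hab⟩ := (cone_d_eq_zero_iff _ _ _).1 hc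
    let a' : ℕ → LinearMap.ker (C.d (n + 2)) := fun i => ⟨a i, congrFun ha i⟩
    -- For a cocycle (a, b), (X - x)a is the coboundary of b, so `a` has trivial class and `a = d
    -- e`. Subtracting the coboundary of (e, 0) leaves first component 0.
    have h1 : toH ∘ a' = 0 := h (by
      rw [shiftSub_comp, map_zero]
      ext i
      refine (toH_eq_zero_iff _).2 ⟨b i, ?_⟩
      have h2 := shiftSub_comp x (LinearMap.ker (C.d (n + 2))).subtype a'
      exact (congrFun hab i).symm.trans (congrFun h2 i))
    obtain ⟨e, hea⟩ := exists_seq_of_forall_exists fun i =>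
      (toH_eq_zero_iff _).1 (congrFun h1 i)
    obtain rfl : C.d (n + 1) ∘ e = a := hea
    have he : C.d (n + 1) ∘ shiftSub (C.X (n + 1)) x e = C.d (n + 1) ∘ b := by
      rw [← hab, ← shiftSub_comp]
    refine ⟨fun i => ⟨b i - shiftSub (C.X (n + 1)) x e i, ?_⟩, ?_⟩
    · rw [LinearMap.mem_ker, map_sub, sub_eq_zero]
      exact (congrFun he i).symm
    · rw [LinearMap.comp_apply, ← sub_eq_zero, ← map_sub, toH_eq_zero_iff]
      refine ⟨(-e, 0), ?_⟩
      refine (cone_d_apply _ _ _).trans (Prod.ext ?_ ?_)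
      · ext i
        change C.d (n + 1) (-e i) = 0 - C.d (n + 1) (e i)
        rw [map_neg, zero_sub]
      · ext i
        change shiftSub (C.X (n + 1)) x (-e) i - C.d n 0 = b i - shiftSub (C.X (n + 1)) x e i - b i
        rw [map_neg, map_zero, Pi.neg_apply]
        abel
  · exact (Submodule.mkQ_surjective _).comp fun a => exists_seq_of_forall_exists fun i =>
      toH_surjective (a i)
  · intro b
    rw [LinearMap.comp_apply, toH_eq_zero_iff]
    have hq : q b = 0 ↔ ∃ e, shiftSub (C.H n) x e = toH ∘ b := by
      rw [LinearMap.comp_apply, Submodule.mkQ_apply, Submodule.Quotient.mk_eq_zero]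
      rfl
    rw [hq]
    constructor
    · rintro ⟨⟨a, c⟩, hac⟩
      have h1 := congrArg Prod.fst hac
      have h2 := congrArg Prod.snd hac
      let a' : ℕ → Z := fun i => ⟨a i, congrFun h1 i⟩
      refine ⟨toH ∘ a', ?_⟩
      rw [shiftSub_comp]
      ext i
      rw [← sub_eq_zero]
      refine (map_sub toH _ _).symm.trans ((toH_eq_zero_iff _).2 ⟨c i, ?_⟩)
      have h3 : shiftSub (C.X (n + 1)) x a i = (shiftSub Z x a' i : C.X (n + 1)) :=
        congrFun (shiftSub_comp x Z.subtype a') i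
      have h4 : shiftSub (C.X (n + 1)) x a i - C.d n (c i) = b i := congrFun h2 i
      rw [h3, sub_eq_iff_eq_add] at h4
      change C.d n (c i) = (shiftSub Z x a' i : C.X (n + 1)) - b i
      rw [h4]
      abel
    · rintro ⟨e, he⟩
      obtain ⟨a, rfl⟩ := exists_seq_of_forall_exists fun i => toH_surjective (e i)
      rw [shiftSub_comp] at he
      obtain ⟨c, hc⟩ := exists_seq_of_forall_exists (f := C.d n)
        (b := Z.subtype ∘ (shiftSub Z x a - b)) fun i => by
          refine (toH_eq_zero_iff (shiftSub Z x a i - b i)).1 ?_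
          rw [map_sub, sub_eq_zero]
          exact congrFun he i
      refine ⟨(Z.subtype ∘ a, c), ?_⟩
      refine (cone_d_apply _ _ _).trans (Prod.ext ?_ ?_)
      · ext i
        exact (a i).2
      · rw [shiftSub_comp, hc]
        ext i
        change (shiftSub Z x a i : C.X (n + 1)) - ((shiftSub Z x a i : C.X (n + 1)) - b i) = b i
        abel

end CochainSeq

section Transport

variable {R M N : Type u} [CommRing R] [AddCommGroup M] [Module R M] [AddCommGroup N] [Module R N]

lemma exact_equiv_zero (e : M ≃ₗ[R] N) :
    Function.Exact e.toLinearMap (0 : N →ₗ[R] PUnit.{u + 1}) := fun n =>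
  ⟨fun _ => ⟨e.symm n, e.apply_symm_apply n⟩, fun _ => rfl⟩

lemma shiftSub_injective_of_subsingleton [Subsingleton M] (x : R) :
    Function.Injective (shiftSub M x) := fun _ _ _ => Subsingleton.elim _ _

lemma shiftSub_injective_of_equiv (e : M ≃ₗ[R] N) {x : R} (h : Function.Injective (shiftSub M x)) :
    Function.Injective (shiftSub N x) :=
  shiftSub_injective_of_exact e.injective (exact_equiv_zero e) h
    (shiftSub_injective_of_subsingleton x)

/-- `LZero` preserves isomorphisms. -/
noncomputable def LZero.congr (e : M ≃ₗ[R] N) (x : R) : LZero M x ≃ₗ[R] LZero N x :=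
  LinearEquiv.ofBijective (LZero.map x e.toLinearMap)
    ⟨LZero.map_injective x e.injective (exact_equiv_zero e) (shiftSub_injective_of_subsingleton x),
      LZero.map_surjective x e.surjective⟩

end Transport

namespace CochainSeq

variable {R : Type u} [CommRing R]

/-- The iterated derived completion of a sequence. -/
def completeList (C : CochainSeq R) : List R → CochainSeq R
  | [] => C
  | x :: l => (completeList C l).complete x

lemma nonempty_completeList_H_equiv [IsNoetherianRing R] (C : CochainSeq R)
    (hC : ∀ n, Module.Finite R (C.H n)) (l : List R) (n : ℕ) :
    Nonempty ((C.completeList l).H n ≃ₗ[R] completion (ModuleCat.of R (C.H n)) l) := by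
  induction l generalizing n with
  | nil => exact ⟨LinearEquiv.refl R _⟩
  | cons x l ih =>
    obtain ⟨e⟩ := ih n
    obtain ⟨e'⟩ := ih (n + 1)
    have : Module.Finite R (ModuleCat.of R (C.H (n + 1))) := hC (n + 1)
    obtain ⟨e''⟩ := nonempty_complete_H_equiv (C := C.completeList l) x n
      (shiftSub_injective_of_equiv e'.symm (shiftSub_completion_injective l x _))
    exact ⟨e''.trans (LZero.congr e x)⟩

lemma isGorensteinInjective_completeList {C : CochainSeq R}
    (hC : ∀ n, IsGorensteinInjective (C.X n)) (l : List R) (n : ℕ) :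
    IsGorensteinInjective ((C.completeList l).X n) := by
  induction l generalizing n with
  | nil => exact hC n
  | cons x l ih =>
    exact IsGorensteinInjective.prod (isGorensteinInjective_pi fun _ => ih (n + 1))
      (isGorensteinInjective_pi fun _ => ih n)

/-- Term n of a cone involves term n + 1, so every completion uses up one leading zero. -/
lemma subsingleton_completeList_of_le {C : CochainSeq R} (l : List R) {k : ℕ}
    (hC : ∀ n ≤ k + l.length, Subsingleton (C.X n)) :
    ∀ n ≤ k, Subsingleton ((C.completeList l).X n) := by
  induction l generalizing k with
  | nil => exact hC
  | cons x l ih =>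
    intro n hn
    have h := ih (k := k + 1) fun m hm => hC m (by rw [List.length_cons]; omega)
    have h1 := h (n + 1) (by omega)
    have h2 := h n (by omega)
    exact inferInstanceAs (Subsingleton
      ((ℕ → (C.completeList l).X (n + 1)) × (ℕ → (C.completeList l).X n)))

lemma subsingleton_completeList_of_ge {C : CochainSeq R} (l : List R) {k : ℕ}
    (hC : ∀ n ≥ k, Subsingleton (C.X n)) :
    ∀ n ≥ k, Subsingleton ((C.completeList l).X n) := by
  induction l with
  | nil => exact hC
  | cons x l ih =>
    intro n hn
    have h1 := ih (n + 1) (by omega)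
    have h2 := ih n hn
    exact inferInstanceAs (Subsingleton
      ((ℕ → (C.completeList l).X (n + 1)) × (ℕ → (C.completeList l).X n)))

/-! ### Derived completeness of the cohomology of Hom(A, T) -/

section Telescope

variable (C : CochainSeq R) (x : R)

/-- The cone of `(y_i) ↦ (y_i - x y_{i+1})`. -/
def telescopeCone : CochainSeq R :=
  C.cone (fun n => telescope (LinearMap.lsmul R (C.X n) x)) fun _ _ => telescope_comp (by simp) _

variable {C x}

/-- The cohomology of this cone is built from kernels and cokernels of the telescope maps on the
cohomology of C. -/
lemma subsingleton_telescopeCone_H (h : ∀ n, DerivedComplete (C.H n) x) (n : ℕ) :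
    Subsingleton ((C.telescopeCone x).H n) := by
  rw [subsingleton_H_iff]
  rintro ⟨a, b⟩ hc
  obtain ⟨ha, hab⟩ := (cone_d_eq_zero_iff _ _ _).1 hc
  let Z := LinearMap.ker (C.d (n + 1))
  let a' : ℕ → LinearMap.ker (C.d (n + 2)) := fun i => ⟨a i, congrFun ha i⟩
  have h1 : toH ∘ a' = 0 := (h (n + 1)).1 (by
    rw [telescope_comp (θ := LinearMap.lsmul R _ x) (by simp), map_zero]
    ext i
    refine (toH_eq_zero_iff _).2 ⟨b i, (congrFun hab i).symm⟩)
  obtain ⟨e, hea⟩ := exists_seq_of_forall_exists fun i =>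
    (toH_eq_zero_iff _).1 (congrFun h1 i)
  obtain rfl : C.d (n + 1) ∘ e = a := hea
  let b' : ℕ → Z := fun i => ⟨b i - telescope (LinearMap.lsmul R _ x) e i, by
    rw [LinearMap.mem_ker, map_sub, sub_eq_zero]
    rw [telescope_comp (θ := LinearMap.lsmul R _ x) (by simp)] at hab
    exact (congrFun hab i).symm⟩
  obtain ⟨β, hβ⟩ := (h n).2 (toH ∘ b')
  obtain ⟨w, rfl⟩ := exists_seq_of_forall_exists fun i => toH_surjective (β i)
  rw [telescope_comp (θ := LinearMap.lsmul R _ x) (by simp)] at hβ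
  obtain ⟨c, hc⟩ := exists_seq_of_forall_exists (f := C.d n)
    (b := Z.subtype ∘ (telescope (LinearMap.lsmul R Z x) w - b')) fun i => by
      refine (toH_eq_zero_iff (telescope (LinearMap.lsmul R Z x) w i - b' i)).1 ?_
      rw [map_sub, sub_eq_zero]
      exact congrFun hβ i
  refine ⟨(e + Z.subtype ∘ w, c), ?_⟩
  refine (cone_d_apply _ _ _).trans (Prod.ext ?_ ?_)
  · ext i
    change C.d (n + 1) (e i + w i) = C.d (n + 1) (e i)
    rw [map_add, (w i).2, add_zero]
  · rw [hc]
    ext i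
    simp [b']
    abel

/-- `H` starts at the term of index 1, so exactness of the cone at index 0 is recorded separately.
-/
lemma telescopeCone_d_zero_injective [Subsingleton (C.X 0)] (h : DerivedComplete (C.H 0) x) :
    Function.Injective ((C.telescopeCone x).d 0) := by
  rw [injective_iff_map_eq_zero]
  rintro ⟨a, b⟩ hc
  obtain ⟨ha, hab⟩ := (cone_d_eq_zero_iff _ _ _).1 hc
  let a' : ℕ → LinearMap.ker (C.d 1) := fun i => ⟨a i, congrFun ha i⟩
  have h1 : toH ∘ a' = 0 := h.1 (by
    rw [telescope_comp (θ := LinearMap.lsmul R _ x) (by simp), map_zero]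
    ext i
    refine (toH_eq_zero_iff _).2 ⟨b i, (congrFun hab i).symm⟩)
  refine Prod.ext ?_ (funext fun i => Subsingleton.elim _ _)
  ext i
  obtain ⟨y, hy⟩ := (toH_eq_zero_iff _).1 (congrFun h1 i)
  rw [Subsingleton.elim y 0, map_zero] at hy
  exact hy.symm

lemma derivedComplete_H_of_telescopeCone
    (h₀ : Function.Injective ((C.telescopeCone x).d 0))
    (h : ∀ n, Subsingleton ((C.telescopeCone x).H n)) (n : ℕ) : DerivedComplete (C.H n) x := by
  constructor
  · rw [injective_iff_map_eq_zero]
    intro y hy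
    obtain ⟨a, rfl⟩ := exists_seq_of_forall_exists fun i => toH_surjective (y i)
    rw [telescope_comp (θ := LinearMap.lsmul R _ x) (by simp)] at hy
    obtain ⟨b, hb⟩ := exists_seq_of_forall_exists fun i => (toH_eq_zero_iff _).1 (congrFun hy i)
    have hc : (C.telescopeCone x).d n (Subtype.val ∘ a, b) = 0 :=
      (cone_d_eq_zero_iff _ _ _).2 ⟨funext fun i => (a i).2, by
        rw [hb]
        ext i
        simp⟩
    ext i
    refine (toH_eq_zero_iff _).2 ?_
    cases n with
    | zero =>
      have h1 := h₀ (hc.trans (map_zero _).symm)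
      refine ⟨0, ?_⟩
      rw [map_zero]
      exact (congrFun (congrArg Prod.fst h1) i).symm
    | succ n =>
      obtain ⟨⟨e, c⟩, hec⟩ := subsingleton_H_iff.1 (h n) _ hc
      exact ⟨e i, congrFun (congrArg Prod.fst hec) i⟩
  · intro y
    obtain ⟨b, rfl⟩ := exists_seq_of_forall_exists fun i => toH_surjective (y i)
    have hc : (C.telescopeCone x).d (n + 1) ((0 : ℕ → C.X (n + 2)), Subtype.val ∘ b) = 0 :=
      (cone_d_eq_zero_iff _ _ _).2 ⟨by ext i; simp, by
        rw [map_zero]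
        ext i
        exact (b i).2.symm⟩
    obtain ⟨⟨e, c⟩, hec⟩ := subsingleton_H_iff.1 (h n) _ hc
    have h1 := congrArg Prod.fst hec
    have h2 := congrArg Prod.snd hec
    let e' : ℕ → LinearMap.ker (C.d (n + 1)) := fun i => ⟨e i, congrFun h1 i⟩
    refine ⟨toH ∘ e', ?_⟩
    rw [telescope_comp (θ := LinearMap.lsmul R _ x) (by simp)]
    ext i
    rw [← sub_eq_zero]
    refine (map_sub toH _ _).symm.trans ((toH_eq_zero_iff _).2 ⟨c i, ?_⟩)
    have h4 : telescope (LinearMap.lsmul R _ x) e i - C.d n (c i) = b i := congrFun h2 i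
    rw [sub_eq_iff_eq_add] at h4
    change C.d n (c i) = telescope (LinearMap.lsmul R _ x) e i - b i
    rw [h4]
    abel

end Telescope

section Hom

/-- The sequence of homomorphisms from a module to the terms of `T`. -/
def homSeq (A : ModuleCat.{u} R) (T : CochainSeq R) : CochainSeq R where
  X n := ModuleCat.of R (A →ₗ[R] T.X n)
  d n := (T.d n).compRight R
  d_d n f := by
    ext a
    exact T.d_d n (f a)

variable {T : CochainSeq R}

/-- A bounded below exact sequence of injectives splits: given `s` in one degree, `id - d s` kills
the image of `d` and so extends along the next differential. -/
lemma exists_splitting (hT : ∀ n, Module.Injective R (T.X n)) (h₀ : Function.Injective (T.d 0))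
    (n : ℕ) (h : ∀ m < n, Subsingleton (T.H m)) :
    ∃ s : T.X (n + 1) →ₗ[R] T.X n, ∀ y, T.d n (s (T.d n y)) = T.d n y := by
  induction n with
  | zero =>
    obtain ⟨s, hs⟩ := (hT 0).exists_comp_eq (T.d 0) LinearMap.id fun x hx =>
      h₀ (hx.trans (map_zero _).symm)
    exact ⟨s, fun y => congrArg (T.d 0) (LinearMap.congr_fun hs y)⟩
  | succ n ih =>
    obtain ⟨s, hs⟩ := ih fun m hm => h m (by omega)
    obtain ⟨s', hs'⟩ := (hT (n + 1)).exists_comp_eq (T.d (n + 1)) (LinearMap.id - T.d n ∘ₗ s)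
      fun x hx => by
        obtain ⟨y, rfl⟩ := subsingleton_H_iff.1 (h n (by omega)) x hx
        simp [hs]
    refine ⟨s', fun y => ?_⟩
    have h1 : s' (T.d (n + 1) y) = y - T.d n (s y) := LinearMap.congr_fun hs' y
    rw [h1, map_sub, T.d_d, sub_zero]

/-- A bounded below sequence of injective modules stays exact under `Hom`. -/
lemma subsingleton_homSeq_H (hT : ∀ n, Module.Injective R (T.X n))
    (h₀ : Function.Injective (T.d 0)) (n : ℕ) (h : ∀ m ≤ n, Subsingleton (T.H m))
    (A : ModuleCat.{u} R) : Subsingleton ((homSeq A T).H n) := by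
  rw [subsingleton_H_iff]
  intro (f : A →ₗ[R] T.X (n + 1)) hf
  obtain ⟨s, hs⟩ := exists_splitting hT h₀ n fun m hm => h m hm.le
  refine ⟨s ∘ₗ f, ?_⟩
  refine LinearMap.ext fun a => ?_
  obtain ⟨y, hy⟩ := subsingleton_H_iff.1 (h n le_rfl) (f a) (LinearMap.congr_fun hf a)
  change T.d n (s (f a)) = f a
  rw [← hy, hs]

/-- The telescope cone of T is a bounded below exact sequence of injectives, so Hom(A, -) keeps it
exact; and Hom(A, -) commutes with the cone. Completeness is then read off from the cone of Hom(A,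
T). -/
lemma derivedComplete_homSeq_H (hT : ∀ n, Module.Injective R (T.X n)) [Subsingleton (T.X 0)] {x : R}
    (h : ∀ n, DerivedComplete (T.H n) x) (A : ModuleCat.{u} R) (n : ℕ) :
    DerivedComplete ((homSeq A T).H n) x := by
  have hQ : ∀ n, Module.Injective R ((T.telescopeCone x).X n) := fun n => by
    have := hT (n + 1)
    have := hT n
    exact module_injective_prod (Module.Injective.pi _ _) (Module.Injective.pi _ _)
  have h₀ := telescopeCone_d_zero_injective (h 0)
  have h' := subsingleton_telescopeCone_H h
  refine derivedComplete_H_of_telescopeCone ?_ ?_ n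
  · rw [injective_iff_map_eq_zero]
    rintro ⟨(a : ℕ → A →ₗ[R] T.X 1), (b : ℕ → A →ₗ[R] T.X 0)⟩ hc
    have h1 := congrArg Prod.fst hc
    have h2 := congrArg Prod.snd hc
    have h3 : ∀ c : A, ((fun i => a i c, fun i => b i c) : (T.telescopeCone x).X 0) = 0 := fun c =>
      h₀ (((cone_d_eq_zero_iff 0 (fun i => a i c) (fun i => b i c)).2
        ⟨funext fun i => LinearMap.congr_fun (congrFun h1 i) c,
          funext fun i => sub_eq_zero.1 (LinearMap.congr_fun (congrFun h2 i) c)⟩).trans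
            (map_zero _).symm)
    refine Prod.ext (funext fun i => LinearMap.ext fun c => ?_)
      (funext fun i => LinearMap.ext fun c => ?_)
    · exact congrFun (congrArg Prod.fst (h3 c)) i
    · exact congrFun (congrArg Prod.snd (h3 c)) i
  · intro n
    rw [subsingleton_H_iff]
    rintro ⟨(a : ℕ → A →ₗ[R] T.X (n + 2)), (b : ℕ → A →ₗ[R] T.X (n + 1))⟩ hc
    have h1 := congrArg Prod.fst hc
    have h2 := congrArg Prod.snd hc
    let f : A →ₗ[R] (ℕ → T.X (n + 2)) × (ℕ → T.X (n + 1)) :=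
      LinearMap.prod (LinearMap.pi a) (LinearMap.pi b)
    have hf : ∀ c : A, (T.telescopeCone x).d (n + 1) (fun i => a i c, fun i => b i c) = 0 :=
      fun c => (cone_d_eq_zero_iff (n + 1) (fun i => a i c) (fun i => b i c)).2
        ⟨funext fun i => LinearMap.congr_fun (congrFun h1 i) c,
          funext fun i => sub_eq_zero.1 (LinearMap.congr_fun (congrFun h2 i) c)⟩
    obtain ⟨g, hg⟩ := subsingleton_H_iff.1
      (subsingleton_homSeq_H hQ h₀ n (fun m _ => h' m) A) f (LinearMap.ext hf)
    let g' : A →ₗ[R] (ℕ → T.X (n + 1)) × (ℕ → T.X n) := g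
    refine ⟨(fun i => LinearMap.proj i ∘ₗ LinearMap.fst R _ _ ∘ₗ g',
      fun i => LinearMap.proj i ∘ₗ LinearMap.snd R _ _ ∘ₗ g'), ?_⟩
    refine Prod.ext (funext fun i => LinearMap.ext fun c => ?_)
      (funext fun i => LinearMap.ext fun c => ?_)
    · exact congrFun (congrArg Prod.fst (LinearMap.congr_fun hg c)) i
    · exact congrFun (congrArg Prod.snd (LinearMap.congr_fun hg c)) i

end Hom

end CochainSeq

/-! ### Injective resolution of a sequence of Gorenstein injective modules -/

namespace CochainSeq

variable {R : Type u} [CommRing R]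

/-- A step in the construction of an injective resolution of a sequence `C` of Gorenstein injective
modules: `P` is the pushout of the part of `C` and of its resolution treated so far, and `I` is an
injective module containing it. -/
structure ResolutionStage (C : CochainSeq R) (n : ℕ) where
  /-- The pushout. -/
  P : ModuleCat.{u} R
  /-- The injective module. -/
  I : ModuleCat.{u} R
  /-- The cokernel of the embedding. -/
  Q : ModuleCat.{u} R
  /-- The map induced by the differential of `C`. -/
  u : P →ₗ[R] C.X (n + 1)
  /-- The embedding. -/
  i : P →ₗ[R] I
  /-- The quotient map. -/
  q : I →ₗ[R] Q
  exists_d_eq : ∀ p, ∃ c, C.d n c = u p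
  exists_u_eq : ∀ c, ∃ p, u p = C.d n c
  ses : IsInjectiveSES i q
  isGorensteinInjective_P : IsGorensteinInjective P
  isGorensteinInjective_Q : IsGorensteinInjective Q

namespace ResolutionStage

variable {C : CochainSeq R}

/-- The first step, for a sequence that starts with zero. -/
def zero (C : CochainSeq R) [Subsingleton (C.X 0)] : ResolutionStage C 0 where
  P := ModuleCat.of R PUnit
  I := ModuleCat.of R PUnit
  Q := ModuleCat.of R PUnit
  u := 0
  i := 0
  q := 0
  exists_d_eq _ := ⟨0, map_zero _⟩
  exists_u_eq c := ⟨0, by rw [Subsingleton.elim c 0, map_zero, map_zero]⟩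
  ses :=
    { injective_mid := module_injective_of_subsingleton _
      f_injective := fun _ _ _ => rfl
      g_surjective := fun _ => ⟨0, rfl⟩
      exact := fun _ => ⟨fun _ => ⟨0, rfl⟩, fun _ => rfl⟩
      lift := fun _ _ _ => ⟨0, rfl⟩ }
  isGorensteinInjective_P := isGorensteinInjective_of_subsingleton (ModuleCat.of R PUnit)
  isGorensteinInjective_Q := isGorensteinInjective_of_subsingleton (ModuleCat.of R PUnit)

variable {n : ℕ} (S : ResolutionStage C n)

/-- The relations of the next pushout. -/
def relation : S.P →ₗ[R] C.X (n + 1) × S.I := S.u.prod (-S.i)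

/-- The next pushout. -/
abbrev NextP : Type u := (C.X (n + 1) × S.I) ⧸ LinearMap.range S.relation

lemma mk_eq_zero_iff (c : C.X (n + 1)) (j : S.I) :
    (Submodule.Quotient.mk (c, j) : S.NextP) = 0 ↔ ∃ p, S.u p = c ∧ -S.i p = j := by
  rw [Submodule.Quotient.mk_eq_zero, LinearMap.mem_range]
  exact exists_congr fun p => Prod.ext_iff

/-- The map from the next pushout induced by the differential of `C`. -/
def nextU : S.NextP →ₗ[R] C.X (n + 2) :=
  Submodule.liftQ _ (C.d (n + 1) ∘ₗ LinearMap.fst R _ _) (by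
    rintro _ ⟨p, rfl⟩
    obtain ⟨c, hc⟩ := S.exists_d_eq p
    change C.d (n + 1) (S.u p) = 0
    rw [← hc, C.d_d])

/-- The pushout is an extension of the cokernel `Q` by `C.X (n + 1)`. -/
lemma isGorensteinInjective_nextP (hC : IsGorensteinInjective (C.X (n + 1))) :
    IsGorensteinInjective (ModuleCat.of R S.NextP) := by
  refine IsGorensteinInjective.of_shortExact (M := ModuleCat.of R S.NextP) hC
    S.isGorensteinInjective_Q (Submodule.mkQ _ ∘ₗ LinearMap.inl R _ _)
    (Submodule.liftQ _ (S.q ∘ₗ LinearMap.snd R _ _) ?_) ?_ ?_ ?_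
  · rintro _ ⟨p, rfl⟩
    change S.q (-S.i p) = 0
    rw [map_neg, S.ses.exact.apply_apply_eq_zero, neg_zero]
  · rw [injective_iff_map_eq_zero]
    intro c hc
    obtain ⟨p, rfl, hp⟩ := (S.mk_eq_zero_iff c 0).1 hc
    rw [neg_eq_zero] at hp
    rw [S.ses.f_injective (hp.trans (map_zero _).symm), map_zero]
  · intro y
    obtain ⟨j, rfl⟩ := S.ses.g_surjective y
    exact ⟨Submodule.Quotient.mk (0, j), rfl⟩
  · intro y
    constructor
    · obtain ⟨⟨c, j⟩, rfl⟩ := Submodule.Quotient.mk_surjective _ y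
      intro hy
      obtain ⟨p, rfl⟩ := (S.ses.exact j).1 hy
      refine ⟨c + S.u p, ?_⟩
      rw [← sub_eq_zero]
      exact (S.mk_eq_zero_iff (c + S.u p - c) (0 - S.i p)).2 ⟨p, by simp⟩
    · rintro ⟨c, rfl⟩
      exact map_zero S.q

/-- The next step. -/
noncomputable def next (hC : IsGorensteinInjective (C.X (n + 1))) : ResolutionStage C (n + 1) :=
  let h := (S.isGorensteinInjective_nextP hC).exists_right
  { P := ModuleCat.of R S.NextP
    I := h.choose_spec.2.choose
    Q := h.choose
    u := S.nextU
    i := h.choose_spec.2.choose_spec.choose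
    q := h.choose_spec.2.choose_spec.choose_spec.choose
    exists_d_eq := fun p => by
      obtain ⟨⟨c, j⟩, rfl⟩ := Submodule.Quotient.mk_surjective _ p
      exact ⟨c, rfl⟩
    exists_u_eq := fun c => ⟨Submodule.Quotient.mk (c, 0), rfl⟩
    ses := h.choose_spec.2.choose_spec.choose_spec.choose_spec
    isGorensteinInjective_P := S.isGorensteinInjective_nextP hC
    isGorensteinInjective_Q := h.choose_spec.1 }

/-- The differential of the resolution. -/
noncomputable def diff (hC : IsGorensteinInjective (C.X (n + 1))) : S.I →ₗ[R] (S.next hC).I :=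
  (S.next hC).i ∘ₗ (Submodule.mkQ (LinearMap.range S.relation) ∘ₗ LinearMap.inr R _ _)

lemma diff_eq_zero_iff (hC : IsGorensteinInjective (C.X (n + 1))) (j : S.I) :
    S.diff hC j = 0 ↔ ∃ p, S.u p = 0 ∧ S.i p = j := by
  refine (map_eq_zero_iff (S.next hC).i (S.next hC).ses.f_injective).trans
    ((S.mk_eq_zero_iff 0 j).trans ⟨?_, ?_⟩)
  · rintro ⟨p, hp, hj⟩
    exact ⟨-p, by rw [map_neg, hp, neg_zero], by rw [map_neg, hj]⟩
  · rintro ⟨p, hp, hj⟩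
    exact ⟨-p, by rw [map_neg, hp, neg_zero], by rw [map_neg, neg_neg, hj]⟩

end ResolutionStage

variable (C : CochainSeq R) [Subsingleton (C.X 0)] (hC : ∀ n, IsGorensteinInjective (C.X n))

/-- The steps of the construction of the resolution. -/
noncomputable def stage : ∀ n, ResolutionStage C n
  | 0 => ResolutionStage.zero C
  | n + 1 => (stage n).next (hC (n + 1))

/-- An injective resolution of a sequence of Gorenstein injective modules. -/
noncomputable def resolution : CochainSeq R where
  X n := (C.stage hC n).I
  d n := (C.stage hC n).diff (hC (n + 1))
  d_d n _ := ((C.stage hC (n + 1)).diff_eq_zero_iff (hC (n + 2)) _).2 ⟨_, map_zero (C.d (n + 1)), rfl⟩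

lemma injective_resolution (n : ℕ) : Module.Injective R ((C.resolution hC).X n) :=
  (C.stage hC n).ses.injective_mid

instance : Subsingleton ((C.resolution hC).X 0) := inferInstanceAs (Subsingleton PUnit)

/-- Cocycles of the resolution are the elements of P killed by `u`; past the end of C these are all
of P. -/
lemma isGorensteinInjective_ker_resolution (n : ℕ) [Subsingleton (C.X (n + 1))] :
    IsGorensteinInjective (ModuleCat.of R (LinearMap.ker ((C.resolution hC).d n))) := by
  refine (C.stage hC n).isGorensteinInjective_P.of_equiv
    (LinearEquiv.ofBijective (LinearMap.codRestrict _ (C.stage hC n).i fun p => ?_) ⟨?_, ?_⟩)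
  · exact ((C.stage hC n).diff_eq_zero_iff (hC (n + 1)) _).2 ⟨p, Subsingleton.elim _ _, rfl⟩
  · exact fun p p' h => (C.stage hC n).ses.f_injective (congrArg Subtype.val h)
  · rintro ⟨j, hj⟩
    obtain ⟨p, -, hp⟩ := ((C.stage hC n).diff_eq_zero_iff (hC (n + 1)) _).1 hj
    exact ⟨p, Subtype.ext hp⟩

/-- Cocycles of the resolution are represented by pairs (c, j) with c a cocycle of C. Such a pair is
a coboundary exactly when c is, since `u` and the differential of C have the same image. -/
lemma nonempty_resolution_H_equiv (n : ℕ) :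
    Nonempty ((C.resolution hC).H n ≃ₗ[R] C.H n) := by
  let S := C.stage hC n
  let Z := LinearMap.ker (C.d (n + 1))
  let p₀ : Z × S.I →ₗ[R] LinearMap.ker ((C.resolution hC).d (n + 1)) :=
    LinearMap.codRestrict _ ((S.next (hC (n + 1))).i ∘ₗ
      (Submodule.mkQ (LinearMap.range S.relation) ∘ₗ Z.subtype.prodMap LinearMap.id)) fun w =>
        ((S.next (hC (n + 1))).diff_eq_zero_iff (hC (n + 2)) _).2
          ⟨(Submodule.Quotient.mk ((w.1 : C.X (n + 1)), w.2) : S.NextP), w.1.2, rfl⟩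
  refine nonempty_linearEquiv_of_ker_eq (p := toH ∘ₗ p₀) (q := toH ∘ₗ LinearMap.fst R Z S.I) ?_ ?_ ?_
  · intro h
    obtain ⟨⟨j, hj⟩, rfl⟩ := toH_surjective h
    obtain ⟨p, hp, hj⟩ := ((S.next (hC (n + 1))).diff_eq_zero_iff (hC (n + 2)) _).1 hj
    obtain ⟨⟨c, j'⟩, rfl⟩ := Submodule.Quotient.mk_surjective _ p
    exact ⟨(⟨c, hp⟩, j'), congrArg toH (Subtype.ext hj)⟩
  · exact toH_surjective.comp LinearMap.fst_surjective
  · rintro ⟨c, j⟩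
    rw [LinearMap.comp_apply, LinearMap.comp_apply, toH_eq_zero_iff, toH_eq_zero_iff]
    have key : ∀ j' : S.I, (C.resolution hC).d n j' = p₀ (c, j) ↔
        ∃ p, S.u p = -(c : C.X (n + 1)) ∧ -S.i p = j' - j := fun j' => by
      refine (S.next (hC (n + 1))).ses.f_injective.eq_iff.trans ?_
      rw [← sub_eq_zero]
      refine Iff.trans ?_ (S.mk_eq_zero_iff (-(c : C.X (n + 1))) (j' - j))
      rw [← zero_sub (c : C.X (n + 1))]
      rfl
    constructor
    · rintro ⟨j', hj'⟩
      obtain ⟨p, hp, -⟩ := (key j').1 hj'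
      obtain ⟨b, hb⟩ := S.exists_d_eq p
      exact ⟨-b, by rw [map_neg, hb, hp, neg_neg]; rfl⟩
    · rintro ⟨b, hb⟩
      obtain ⟨p, hp⟩ := S.exists_u_eq b
      refine ⟨j + S.i p, (key _).2 ⟨-p, ?_, ?_⟩⟩
      · rw [map_neg, hp, hb]
        rfl
      · rw [map_neg]
        abel

end CochainSeq

/-! ### Vanishing of the cohomology of Hom(A, T) as a property of A -/

section Image

variable {R M N P : Type u} [CommRing R] [AddCommGroup M] [Module R M] [AddCommGroup N] [Module R N]
  [AddCommGroup P] [Module R P]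

lemma LinearMap.exact_ker_rangeRestrict (φ : M →ₗ[R] N) :
    Function.Exact (LinearMap.ker φ).subtype φ.rangeRestrict := fun z => by
  constructor
  · intro hz
    exact ⟨⟨z, congrArg Subtype.val hz⟩, rfl⟩
  · rintro ⟨w, rfl⟩
    exact Subtype.ext w.2

lemma LinearMap.exact_range_subtype {φ : M →ₗ[R] N} {g : N →ₗ[R] P} (h : Function.Exact φ g) :
    Function.Exact (LinearMap.range φ).subtype g := fun z =>
  (h z).trans ⟨fun hz => ⟨⟨z, hz⟩, rfl⟩, by rintro ⟨w, rfl⟩; exact w.2⟩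

end Image

namespace CochainSeq

variable {R : Type u} [CommRing R] {T : CochainSeq R}

variable (T) in
/-- Vanishing of the cohomology of `Hom(A, T)` at the index `n + 1`. -/
def HomVanishes (n : ℕ) (A : ModuleCat.{u} R) : Prop := Subsingleton ((homSeq A T).H n)

lemma homVanishes_iff {n : ℕ} {A : ModuleCat.{u} R} :
    T.HomVanishes n A ↔ ∀ f : A →ₗ[R] T.X (n + 1), T.d (n + 1) ∘ₗ f = 0 →
      ∃ g : A →ₗ[R] T.X n, T.d n ∘ₗ g = f :=
  subsingleton_H_iff

lemma homVanishes_of_subsingleton (n : ℕ) (A : ModuleCat.{u} R) [Subsingleton A] :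
    T.HomVanishes n A :=
  homVanishes_iff.2 fun _ _ => ⟨0, LinearMap.ext fun a => by
    rw [Subsingleton.elim a 0, map_zero, map_zero]⟩

lemma HomVanishes.of_retract {n : ℕ} {A V : ModuleCat.{u} R} (h : T.HomVanishes n V)
    (s : A →ₗ[R] V) (r : V →ₗ[R] A) (hrs : r ∘ₗ s = LinearMap.id) : T.HomVanishes n A := by
  rw [homVanishes_iff] at h ⊢
  intro f hf
  obtain ⟨g, hg⟩ := h (f ∘ₗ r) (by rw [← LinearMap.comp_assoc, hf, LinearMap.zero_comp])
  exact ⟨g ∘ₗ s, by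
    rw [← LinearMap.comp_assoc, hg, LinearMap.comp_assoc, hrs, LinearMap.comp_id]⟩

lemma HomVanishes.of_equiv {n : ℕ} {A V : ModuleCat.{u} R} (h : T.HomVanishes n V)
    (e : A ≃ₗ[R] V) : T.HomVanishes n A :=
  h.of_retract e.toLinearMap e.symm.toLinearMap (by ext; simp)

lemma HomVanishes.finsupp {n : ℕ} {A : ModuleCat.{u} R} (h : T.HomVanishes n A) (ι : Type u) :
    T.HomVanishes n (ModuleCat.of R (ι →₀ A)) := by
  rw [homVanishes_iff] at h ⊢
  intro (f : (ι →₀ A) →ₗ[R] T.X (n + 1)) hf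
  choose g hg using fun i => h (f ∘ₗ Finsupp.lsingle i) (by
    rw [← LinearMap.comp_assoc, hf, LinearMap.zero_comp])
  refine ⟨Finsupp.lsum ℕ g, ?_⟩
  refine Finsupp.lhom_ext' fun i => ?_
  rw [← hg i]
  ext a
  simp

/-- Hom(F ⊗ B, T) = Hom(F, Hom(B, T)), and Hom(F, -) is exact. -/
lemma HomVanishes.projective_tensor {n : ℕ} {F B : ModuleCat.{u} R} [Module.Projective R F]
    (h : T.HomVanishes n B) : T.HomVanishes n (ModuleCat.of R (TensorProduct R F B)) := by
  rw [homVanishes_iff] at h ⊢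
  intro (f : TensorProduct R F B →ₗ[R] T.X (n + 1)) hf
  let Z : Submodule R (B →ₗ[R] T.X (n + 1)) := LinearMap.ker ((T.d (n + 1)).compRight R)
  let δ : (B →ₗ[R] T.X n) →ₗ[R] Z := LinearMap.codRestrict Z ((T.d n).compRight R) fun g =>
    LinearMap.ext fun b => T.d_d n (g b)
  have hδ : Function.Surjective δ := by
    rintro ⟨g, hg⟩
    obtain ⟨k, hk⟩ := h g hg
    exact ⟨k, Subtype.ext hk⟩
  obtain ⟨g, hg⟩ := Module.projective_lifting_property δ
    (LinearMap.codRestrict Z (TensorProduct.curry f) fun a =>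
      LinearMap.ext fun b => LinearMap.congr_fun hf (a ⊗ₜ b)) hδ
  refine ⟨TensorProduct.lift g, ?_⟩
  refine TensorProduct.ext' fun a b => ?_
  exact LinearMap.congr_fun (congrArg Subtype.val (LinearMap.congr_fun hg a)) b

section ShortExact

variable {A B C : ModuleCat.{u} R} {i : A →ₗ[R] B} {p : B →ₗ[R] C}

lemma exists_comp_eq_of_comp_eq_zero {E : Type u} [AddCommGroup E] [Module R E]
    (hp : Function.Surjective p) (hip : Function.Exact i p) (f : B →ₗ[R] E) (hf : f ∘ₗ i = 0) :
    ∃ g : C →ₗ[R] E, g ∘ₗ p = f :=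
  exists_comp_eq_of_ker_le hp f fun x hx => by
    obtain ⟨a, rfl⟩ := (hip x).1 hx
    exact LinearMap.congr_fun hf a

lemma exists_comp_injective_eq {E : Type u} [AddCommGroup E] [Module R E]
    (hE : Module.Injective R E) (hi : Function.Injective i) (f : A →ₗ[R] E) :
    ∃ g : B →ₗ[R] E, g ∘ₗ i = f :=
  hE.exists_comp_eq i f fun x hx => by rw [hi (hx.trans (map_zero i).symm), map_zero]

lemma eq_zero_of_comp_surjective {E : Type u} [AddCommGroup E] [Module R E]
    (hp : Function.Surjective p) {f : C →ₗ[R] E} (hf : f ∘ₗ p = 0) : f = 0 := by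
  rwa [← LinearMap.cancel_right hp, LinearMap.zero_comp]

lemma d_comp_d_comp {E : Type u} [AddCommGroup E] [Module R E] (n : ℕ) (f : E →ₗ[R] T.X n) :
    T.d (n + 1) ∘ₗ T.d n ∘ₗ f = 0 := LinearMap.ext fun _ => T.d_d n _

/-- The obstruction to extending a cocycle from A to B is its connecting class on C, one degree
higher. -/
lemma exists_extension (hT : ∀ n, Module.Injective R (T.X n)) (hi : Function.Injective i)
    (hp : Function.Surjective p) (hip : Function.Exact i p) {n : ℕ} (hC : T.HomVanishes (n + 1) C)
    (f : A →ₗ[R] T.X (n + 1)) (hf : T.d (n + 1) ∘ₗ f = 0) :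
    ∃ F : B →ₗ[R] T.X (n + 1), T.d (n + 1) ∘ₗ F = 0 ∧ F ∘ₗ i = f := by
  obtain ⟨F, rfl⟩ := exists_comp_injective_eq (hT (n + 1)) hi f
  obtain ⟨w, hw⟩ := exists_comp_eq_of_comp_eq_zero hp hip (T.d (n + 1) ∘ₗ F) hf
  obtain ⟨g, rfl⟩ := homVanishes_iff.1 hC w (eq_zero_of_comp_surjective hp (by
    rw [LinearMap.comp_assoc, hw, d_comp_d_comp]))
  refine ⟨F - g ∘ₗ p, ?_, ?_⟩
  · rw [LinearMap.comp_sub, ← hw, LinearMap.comp_assoc, sub_self]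
  · rw [LinearMap.sub_comp, LinearMap.comp_assoc, hip.linearMap_comp_eq_zero, LinearMap.comp_zero,
      sub_zero]

lemma HomVanishes.of_shortExact_left (hT : ∀ n, Module.Injective R (T.X n))
    (hi : Function.Injective i) (hp : Function.Surjective p) (hip : Function.Exact i p) {n : ℕ}
    (hB : T.HomVanishes n B) (hC : T.HomVanishes (n + 1) C) : T.HomVanishes n A := by
  rw [homVanishes_iff]
  intro f hf
  obtain ⟨F, hF, rfl⟩ := exists_extension hT hi hp hip hC f hf
  obtain ⟨G, rfl⟩ := homVanishes_iff.1 hB F hF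
  exact ⟨G ∘ₗ i, rfl⟩

lemma HomVanishes.of_shortExact_mid (hT : ∀ n, Module.Injective R (T.X n))
    (hi : Function.Injective i) (hp : Function.Surjective p) (hip : Function.Exact i p) {n : ℕ}
    (hA : T.HomVanishes n A) (hC : T.HomVanishes n C) : T.HomVanishes n B := by
  rw [homVanishes_iff]
  intro f hf
  obtain ⟨g, hg⟩ := homVanishes_iff.1 hA (f ∘ₗ i) (by
    rw [← LinearMap.comp_assoc, hf, LinearMap.zero_comp])
  obtain ⟨G, rfl⟩ := exists_comp_injective_eq (hT n) hi g
  obtain ⟨w, hw⟩ := exists_comp_eq_of_comp_eq_zero hp hip (f - T.d n ∘ₗ G) (by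
    rw [LinearMap.sub_comp, LinearMap.comp_assoc, hg, sub_self])
  obtain ⟨k, rfl⟩ := homVanishes_iff.1 hC w (eq_zero_of_comp_surjective hp (by
    rw [LinearMap.comp_assoc, hw, LinearMap.comp_sub, hf, d_comp_d_comp, sub_zero]))
  refine ⟨G + k ∘ₗ p, ?_⟩
  rw [LinearMap.comp_add, ← LinearMap.comp_assoc, hw]
  abel

lemma HomVanishes.of_shortExact_right (hT : ∀ n, Module.Injective R (T.X n))
    (hi : Function.Injective i) (hp : Function.Surjective p) (hip : Function.Exact i p) {n : ℕ}
    (hA : T.HomVanishes n A) (hB : T.HomVanishes (n + 1) B) : T.HomVanishes (n + 1) C := by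
  rw [homVanishes_iff]
  intro f hf
  obtain ⟨g, hg⟩ := homVanishes_iff.1 hB (f ∘ₗ p) (by
    rw [← LinearMap.comp_assoc, hf, LinearMap.zero_comp])
  obtain ⟨k, hk⟩ := homVanishes_iff.1 hA (g ∘ₗ i) (by
    rw [← LinearMap.comp_assoc, hg, LinearMap.comp_assoc, hip.linearMap_comp_eq_zero,
      LinearMap.comp_zero])
  obtain ⟨G, rfl⟩ := exists_comp_injective_eq (hT n) hi k
  obtain ⟨w, hw⟩ := exists_comp_eq_of_comp_eq_zero hp hip (g - T.d n ∘ₗ G) (by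
    rw [LinearMap.sub_comp, LinearMap.comp_assoc, hk, sub_self])
  refine ⟨w, (LinearMap.cancel_right hp).1 ?_⟩
  rw [LinearMap.comp_assoc, hw, LinearMap.comp_sub, hg, d_comp_d_comp, sub_zero]

/-- As `T.X 0` is zero, vanishing at index 0 means that there are no nonzero maps into the cocycles
of `T.X 1`. -/
lemma HomVanishes.zero_of_surjective [Subsingleton (T.X 0)] (hp : Function.Surjective p)
    (hB : T.HomVanishes 0 B) : T.HomVanishes 0 C := by
  rw [homVanishes_iff]
  intro f hf
  obtain ⟨g, hg⟩ := homVanishes_iff.1 hB (f ∘ₗ p) (by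
    rw [← LinearMap.comp_assoc, hf, LinearMap.zero_comp])
  refine ⟨0, (LinearMap.cancel_right hp).1 ?_⟩
  rw [← hg, Subsingleton.elim g 0, LinearMap.comp_zero, LinearMap.zero_comp, LinearMap.comp_zero]

end ShortExact

section Tensor

variable {K F X B : ModuleCat.{u} R} {f : K →ₗ[R] F} {g : F →ₗ[R] X}

lemma HomVanishes.range_rTensor_of_tensor [Module.Projective R F]
    (hT : ∀ n, Module.Injective R (T.X n)) (hg : Function.Surjective g) (hfg : Function.Exact f g)
    {n : ℕ} (hB : T.HomVanishes n B)
    (h : T.HomVanishes (n + 1) (ModuleCat.of R (TensorProduct R X B))) :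
    T.HomVanishes n (ModuleCat.of R (LinearMap.range (f.rTensor B))) :=
  HomVanishes.of_shortExact_left (A := ModuleCat.of R (LinearMap.range (f.rTensor B)))
    (B := ModuleCat.of R (TensorProduct R F B)) (C := ModuleCat.of R (TensorProduct R X B)) hT
    (i := (LinearMap.range (f.rTensor B)).subtype) (p := g.rTensor B)
    (Submodule.subtype_injective _) (g.rTensor_surjective B hg)
    (LinearMap.exact_range_subtype (rTensor_exact B hfg hg)) (projective_tensor (F := F) hB) h

lemma HomVanishes.tensor_of_range_rTensor [Module.Projective R F]
    (hT : ∀ n, Module.Injective R (T.X n)) (hg : Function.Surjective g) (hfg : Function.Exact f g)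
    {n : ℕ} (hB : T.HomVanishes (n + 1) B)
    (h : T.HomVanishes n (ModuleCat.of R (LinearMap.range (f.rTensor B)))) :
    T.HomVanishes (n + 1) (ModuleCat.of R (TensorProduct R X B)) :=
  HomVanishes.of_shortExact_right (A := ModuleCat.of R (LinearMap.range (f.rTensor B)))
    (B := ModuleCat.of R (TensorProduct R F B)) (C := ModuleCat.of R (TensorProduct R X B)) hT
    (i := (LinearMap.range (f.rTensor B)).subtype) (p := g.rTensor B)
    (Submodule.subtype_injective _) (g.rTensor_surjective B hg)
    (LinearMap.exact_range_subtype (rTensor_exact B hfg hg)) h (projective_tensor (F := F) hB)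

end Tensor

/-! ### Reduction to and from the residue field -/

section Local

variable [IsLocalRing R]

open IsLocalRing

lemma exists_equiv_finsupp_residueField {V : ModuleCat.{u} R}
    (hV : ∀ x ∈ maximalIdeal R, ∀ v : V, x • v = 0) :
    ∃ ι : Type u, Nonempty (V ≃ₗ[R] (ι →₀ ResidueField R)) := by
  have ht : Module.IsTorsionBySet R V (maximalIdeal R) := fun v x => hV x x.2 v
  let _ : Module (ResidueField R) V := ht.module
  have : IsScalarTower R (ResidueField R) V := ht.isScalarTower
  exact ⟨_, ⟨(Module.Basis.ofVectorSpace (ResidueField R) V).repr.restrictScalars R⟩⟩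

lemma HomVanishes.of_smul_eq_zero {n : ℕ} {V : ModuleCat.{u} R}
    (h : T.HomVanishes n (ModuleCat.of R (ResidueField R)))
    (hV : ∀ x ∈ maximalIdeal R, ∀ v : V, x • v = 0) : T.HomVanishes n V := by
  obtain ⟨ι, ⟨e⟩⟩ := exists_equiv_finsupp_residueField hV
  exact (h.finsupp ι).of_equiv e

lemma HomVanishes.residueField {n : ℕ} {V : ModuleCat.{u} R} [Nontrivial V]
    (h : T.HomVanishes n V) (hV : ∀ x ∈ maximalIdeal R, ∀ v : V, x • v = 0) :
    T.HomVanishes n (ModuleCat.of R (ResidueField R)) := by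
  obtain ⟨ι, ⟨e⟩⟩ := exists_equiv_finsupp_residueField hV
  have hι : Nonempty ι := by
    by_contra hc
    rw [not_nonempty_iff] at hc
    exact not_subsingleton V e.toEquiv.subsingleton
  obtain ⟨a⟩ := hι
  have h' : T.HomVanishes n (ModuleCat.of R (ι →₀ ResidueField R)) := h.of_equiv e.symm
  exact h'.of_retract (A := ModuleCat.of R (ResidueField R)) (Finsupp.lsingle a) (Finsupp.lapply a)
    (by ext; simp)

/-- Elements of the maximal ideal act on `X` through projective modules. -/
def StablyKilled (X : ModuleCat.{u} R) : Prop :=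
  ∀ x ∈ maximalIdeal R, ∃ (G : ModuleCat.{u} R) (α : X →ₗ[R] G) (β : G →ₗ[R] X),
    Module.Projective R G ∧ ∀ z, β (α z) = x • z

section Syzygy

variable {K F X B : ModuleCat.{u} R} {f : K →ₗ[R] F} {g : F →ₗ[R] X}

/-- Lifting β through F corrects multiplication by `x` on F to a map into K. It follows that
syzygies stay stably killed and that `x` kills Tor₁(X, B). -/
lemma StablyKilled.exists_homotopy [Module.Projective R F] (hX : StablyKilled X) (hf : Function.Injective f)
    (hg : Function.Surjective g) (hfg : Function.Exact f g) {x : R} (hx : x ∈ maximalIdeal R) :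
    ∃ σ : F →ₗ[R] K, ∀ z, σ (f z) = x • z := by
  obtain ⟨G, α, β, hG, hαβ⟩ := hX x hx
  obtain ⟨β', hβ'⟩ := Module.projective_lifting_property g β hg
  obtain ⟨σ, hσ⟩ := exists_comp_eq_of_mem_range hf
    (LinearMap.lsmul R F x - β' ∘ₗ α ∘ₗ g) fun y => (hfg _).1 (by
      have h1 : g (β' (α (g y))) = β (α (g y)) := LinearMap.congr_fun hβ' _
      simp [h1, hαβ])
  refine ⟨σ, fun z => hf ?_⟩
  have h1 : f (σ (f z)) = x • f z - β' (α (g (f z))) := LinearMap.congr_fun hσ (f z)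
  rw [h1, hfg.apply_apply_eq_zero, map_zero, map_zero, sub_zero, map_smul]

lemma StablyKilled.syzygy [Module.Projective R F] (hX : StablyKilled X) (hf : Function.Injective f)
    (hg : Function.Surjective g) (hfg : Function.Exact f g) : StablyKilled K := fun x hx => by
  obtain ⟨σ, hσ⟩ := hX.exists_homotopy hf hg hfg hx
  exact ⟨F, f, σ, inferInstance, hσ⟩

lemma StablyKilled.smul_eq_zero [Module.Projective R F] (hX : StablyKilled X) (hf : Function.Injective f)
    (hg : Function.Surjective g) (hfg : Function.Exact f g) (x : R) (hx : x ∈ maximalIdeal R)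
    (v : ModuleCat.of R (LinearMap.ker (f.rTensor B))) : x • v = 0 := by
  obtain ⟨σ, hσ⟩ := hX.exists_homotopy hf hg hfg hx
  have h1 : σ ∘ₗ f = x • LinearMap.id := LinearMap.ext hσ
  have h2 : x • (v : TensorProduct R K B) = σ.rTensor B (f.rTensor B v) := by
    rw [← LinearMap.comp_apply, ← LinearMap.rTensor_comp, h1, LinearMap.rTensor_smul,
      LinearMap.rTensor_id]
    rfl
  refine Subtype.ext ?_
  change x • (v : TensorProduct R K B) = 0
  rw [h2, v.2, map_zero]

end Syzygy

variable [IsNoetherianRing R]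

/-- Induction on the generators not yet known to kill A, with dévissage along the first of them. -/
lemma homVanishes_of_residueField (hT : ∀ n, Module.Injective R (T.X n)) (l : List R) (s : Set R)
    (hl : maximalIdeal R ≤ Ideal.span (s ∪ {x | x ∈ l}))
    (hdc : ∀ x ∈ l, ∀ (A : ModuleCat.{u} R) (n : ℕ), DerivedComplete ((homSeq A T).H n) x)
    (hk : ∀ n, T.HomVanishes n (ModuleCat.of R (ResidueField R)))
    (A : ModuleCat.{u} R) (hA : Module.Finite R A) (hs : ∀ x ∈ s, ∀ a : A, x • a = 0) (n : ℕ) :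
    T.HomVanishes n A := by
  induction l generalizing s A n with
  | nil =>
    refine (hk n).of_smul_eq_zero fun x hx a => ?_
    have h1 : Ideal.span (s ∪ {x | x ∈ ([] : List R)}) ≤ Module.annihilator R A := by
      rw [Ideal.span_le]
      rintro y (hy | hy)
      · exact Module.mem_annihilator.2 (hs y hy)
      · simp at hy
    exact Module.mem_annihilator.1 (h1 (hl hx)) a
  | cons x l ih =>
    have hkill : ∀ A : ModuleCat.{u} R, Module.Finite R A → (∀ a : A, x • a = 0) →
        (∀ y ∈ s, ∀ a : A, y • a = 0) → ∀ n, T.HomVanishes n A := by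
      intro A hA hx hs n
      refine ih (insert x s) (hl.trans (Ideal.span_mono ?_))
        (fun y hy => hdc y (List.mem_cons_of_mem _ hy)) A hA ?_ n
      · rintro y (hy | hy)
        · exact Or.inl (Or.inr hy)
        · rcases List.mem_cons.1 hy with rfl | hy
          · exact Or.inl (Or.inl rfl)
          · exact Or.inr hy
      · rintro y (rfl | hy)
        · exact hx
        · exact hs y hy
    refine devissage_smul x (fun A => (∀ y ∈ s, ∀ a : A, y • a = 0) → ∀ n, T.HomVanishes n A)
      ?_ ?_ ?_ A hA hs n
    · intro A B C f g _ _ _ hf hg hfg hA hC hs n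
      refine HomVanishes.of_shortExact_mid hT hf hg hfg (hA (fun y hy a => hf ?_) n)
        (hC (fun y hy c => ?_) n)
      · rw [map_smul, hs y hy, map_zero]
      · obtain ⟨b, rfl⟩ := hg c
        rw [← map_smul, hs y hy, map_zero]
    · exact hkill
    · intro A hA hinj hs n
      -- The vanishing for A/xA makes multiplication by `x` surjective on the cohomology of Hom(A,
      -- T), and derived completeness turns this into vanishing.
      refine (hdc x List.mem_cons_self A n).subsingleton fun c => ?_
      obtain ⟨⟨f, hf⟩, rfl⟩ := toH_surjective c
      obtain ⟨F, hF, hFf⟩ := exists_extension (A := A) (B := A)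
        (C := ModuleCat.of R (A ⧸ LinearMap.range (LinearMap.lsmul R A x))) hT
        (i := LinearMap.lsmul R A x) (p := Submodule.mkQ _)
        ((injective_iff_map_eq_zero _).2 hinj) (Submodule.mkQ_surjective _)
        (LinearMap.exact_map_mkQ_range _)
        (hkill _ (inferInstanceAs (Module.Finite R (A ⧸ _))) (fun a => by
          obtain ⟨a, rfl⟩ := Submodule.Quotient.mk_surjective _ a
          exact (Submodule.Quotient.mk_eq_zero _).2 ⟨a, rfl⟩) (fun y hy a => by
          obtain ⟨a, rfl⟩ := Submodule.Quotient.mk_surjective _ a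
          exact congrArg Submodule.Quotient.mk (hs y hy a)) (n + 1)) f hf
      refine ⟨toH ⟨F, hF⟩, ?_⟩
      rw [← map_smul]
      exact congrArg toH (Subtype.ext ((LinearMap.ext fun a => (map_smul F x a).symm).trans hFf))

/-- Hom out of X ⊗ᴸ B vanishes. The higher Tor modules are killed by m and affect X ⊗ B at index i
only through smaller indices, which `hk` covers. -/
lemma homVanishes_tensor [Subsingleton (T.X 0)] (hT : ∀ n, Module.Injective R (T.X n))
    {B : ModuleCat.{u} R} (hB : ∀ n, T.HomVanishes n B) {n : ℕ}
    (hk : ∀ i < n, T.HomVanishes i (ModuleCat.of R (ResidueField R))) (i : ℕ) (hi : i ≤ n)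
    (X : ModuleCat.{u} R) [Module.Finite R X] (hX : StablyKilled X) :
    T.HomVanishes i (ModuleCat.of R (TensorProduct R X B)) := by
  induction i generalizing X with
  | zero =>
    obtain ⟨K, F, f, g, hK, hF, hF', hf, hg, hfg⟩ := exists_finite_free_cover X
    exact HomVanishes.zero_of_surjective (B := ModuleCat.of R (TensorProduct R F B))
      (C := ModuleCat.of R (TensorProduct R X B)) (p := g.rTensor B)
      (g.rTensor_surjective B hg) (HomVanishes.projective_tensor (F := F) (hB 0))
  | succ i ih =>
    obtain ⟨K, F, f, g, hK, hF, hF', hf, hg, hfg⟩ := exists_finite_free_cover X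
    have h1 : T.HomVanishes i (ModuleCat.of R (TensorProduct R K B)) :=
      ih (by omega) K (hX.syzygy hf hg hfg)
    refine HomVanishes.tensor_of_range_rTensor hT hg hfg (hB (i + 1)) ?_
    cases i with
    | zero =>
      exact HomVanishes.zero_of_surjective (p := (f.rTensor B).rangeRestrict)
        (LinearMap.surjective_rangeRestrict _) h1
    | succ j =>
      have h3 : T.HomVanishes j (ModuleCat.of R (LinearMap.ker (f.rTensor B))) :=
        (hk j (by omega)).of_smul_eq_zero (hX.smul_eq_zero hf hg hfg)
      exact HomVanishes.of_shortExact_right hT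
        (i := (LinearMap.ker (f.rTensor B)).subtype) (p := (f.rTensor B).rangeRestrict)
        (Submodule.subtype_injective _) (LinearMap.surjective_rangeRestrict _)
        (LinearMap.exact_ker_rangeRestrict (f.rTensor B)) h3 h1

/-- The kernel of `f ⊗ B` is Tor₁(X, B), a nonzero vector space over k with k as a direct summand.
Its vanishing at n follows from K ⊗ B at n and the image of `f ⊗ B` at n + 1. -/
lemma StablyKilled.homVanishes_residueField [Subsingleton (T.X 0)]
    (hT : ∀ n, Module.Injective R (T.X n))
    {K F X B : ModuleCat.{u} R} {f : K →ₗ[R] F} {g : F →ₗ[R] X} [Module.Finite R K]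
    [Module.Projective R F] (hX : StablyKilled X) (hB : ∀ n, T.HomVanishes n B) {n : ℕ}
    (hk : ∀ i < n, T.HomVanishes i (ModuleCat.of R (ResidueField R)))
    (hf : Function.Injective f) (hg : Function.Surjective g) (hfg : Function.Exact f g)
    (hXB : ∀ i, T.HomVanishes i (ModuleCat.of R (TensorProduct R X B)))
    (hinj : ¬ Function.Injective (f.rTensor B)) :
    T.HomVanishes n (ModuleCat.of R (ResidueField R)) := by
  have hnt : Nontrivial (ModuleCat.of R (LinearMap.ker (f.rTensor B))) := by
    rw [← LinearMap.ker_eq_bot] at hinj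
    exact Submodule.nontrivial_iff_ne_bot.2 hinj
  refine HomVanishes.residueField (V := ModuleCat.of R (LinearMap.ker (f.rTensor B))) ?_
    (hX.smul_eq_zero hf hg hfg)
  exact HomVanishes.of_shortExact_left (B := ModuleCat.of R (TensorProduct R K B)) hT
    (i := (LinearMap.ker (f.rTensor B)).subtype) (p := (f.rTensor B).rangeRestrict)
    (Submodule.subtype_injective _) (LinearMap.surjective_rangeRestrict _)
    (LinearMap.exact_ker_rangeRestrict (f.rTensor B))
    (homVanishes_tensor hT hB hk n le_rfl K (hX.syzygy hf hg hfg))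
    (HomVanishes.range_rTensor_of_tensor hT hg hfg (hB (n + 1)) (hXB (n + 2)))

/-- Passing to syzygies until Tor₁ is nonzero: as long as it vanishes, K ⊗ B embeds in F ⊗ B and
inherits the vanishing. -/
lemma homVanishes_residueField_of_not_torVanishes [Subsingleton (T.X 0)]
    (hT : ∀ n, Module.Injective R (T.X n))
    {B : ModuleCat.{u} R} (hB : ∀ n, T.HomVanishes n B) {n : ℕ}
    (hk : ∀ i < n, T.HomVanishes i (ModuleCat.of R (ResidueField R))) (t : ℕ)
    (X : ModuleCat.{u} R) [Module.Finite R X] (hX : StablyKilled X)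
    (hXB : ∀ i, T.HomVanishes i (ModuleCat.of R (TensorProduct R X B)))
    (ht : ¬ TorVanishes (t + 1) X B) :
    T.HomVanishes n (ModuleCat.of R (ResidueField R)) := by
  induction t generalizing X with
  | zero =>
    obtain ⟨K, F, f, g, hK, hF, hF', hf, hg, hfg⟩ := exists_finite_free_cover X
    refine hX.homVanishes_residueField hT hB hk hf hg hfg hXB ?_
    rwa [torVanishes_one_iff hf hg hfg] at ht
  | succ t ih =>
    obtain ⟨K, F, f, g, hK, hF, hF', hf, hg, hfg⟩ := exists_finite_free_cover X
    by_cases hinj : Function.Injective (f.rTensor B)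
    · rw [torVanishes_succ_succ_iff hf hg hfg] at ht
      refine ih K (hX.syzygy hf hg hfg) (fun i => ?_) ht
      exact (HomVanishes.range_rTensor_of_tensor hT hg hfg (hB i) (hXB (i + 1))).of_equiv
        (A := ModuleCat.of R (TensorProduct R K B)) (LinearEquiv.ofInjective _ hinj)
    · exact hX.homVanishes_residueField hT hB hk hf hg hfg hXB hinj

/-- If `Hom(B, T)` is exact for a module `B` of finite width, then `Hom(k, T)` is exact. -/
theorem homVanishes_residueField [Subsingleton (T.X 0)] (hT : ∀ n, Module.Injective R (T.X n))
    {B : ModuleCat.{u} R} (hB : ∀ n, T.HomVanishes n B) (hw : moduleWidth B < ⊤) (n : ℕ) :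
    T.HomVanishes n (ModuleCat.of R (ResidueField R)) := by
  induction n using Nat.strong_induction_on with
  | _ n hk =>
  have hfin : Module.Finite R (ModuleCat.of R (ResidueField R)) :=
    inferInstanceAs (Module.Finite R (ResidueField R))
  have hzero : ∀ x ∈ maximalIdeal R, ∀ z : ModuleCat.of R (ResidueField R), x • z = 0 :=
    fun x hx (z : ResidueField R) => by
      rw [Algebra.smul_def, ResidueField.algebraMap_eq, (residue_eq_zero_iff x).2 hx, zero_mul]
  have hX : StablyKilled (ModuleCat.of R (ResidueField R)) := fun x hx =>
    ⟨ModuleCat.of R PUnit.{u + 1}, 0, 0, inferInstanceAs (Module.Projective R PUnit.{u + 1}),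
      fun z => (hzero x hx z).symm⟩
  by_cases hs : Subsingleton (ModuleCat.of R (TensorProduct R (ResidueField R) B))
  -- If k ⊗ B = 0, finite width supplies a nonzero Tor in positive degree; otherwise k is a direct
  -- summand of k ⊗ B itself.
  · obtain ⟨t, ht⟩ := exists_not_torVanishes_of_moduleWidth_lt_top hw
    cases t with
    | zero => exact absurd ((torVanishes_zero_iff _ _).2 hs) ht
    | succ t =>
      exact homVanishes_residueField_of_not_torVanishes hT hB hk t _ hX
        (fun i => homVanishes_of_subsingleton i
          (ModuleCat.of R (TensorProduct R (ResidueField R) B))) ht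
  · rw [not_subsingleton_iff_nontrivial] at hs
    refine (homVanishes_tensor hT hB hk n le_rfl (ModuleCat.of R (ResidueField R)) hX).residueField
      fun x hx z => ?_
    induction z using TensorProduct.induction_on with
    | zero => exact smul_zero x
    | tmul a b => exact (TensorProduct.smul_tmul' x a b).trans (by
        rw [show x • a = 0 from hzero x hx a, TensorProduct.zero_tmul])
    | add a b ha hb => rw [smul_add, ha, hb, add_zero]

end Local

end CochainSeq

/-! ### The width count and the main inequality -/

namespace CochainSeq

open IsLocalRing

variable {R : Type u} [CommRing R] {T : CochainSeq R}

lemma subsingleton_H_of_homVanishes {n : ℕ} (h : T.HomVanishes n (ModuleCat.of R R)) :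
    Subsingleton (T.H n) := by
  rw [subsingleton_H_iff]
  intro x hx
  obtain ⟨g, hg⟩ := homVanishes_iff.1 h (LinearMap.toSpanSingleton R _ x)
    (LinearMap.ext_ring (by simpa using hx))
  refine ⟨g (1 : R), ?_⟩
  simpa using LinearMap.congr_fun hg (1 : R)

variable (T) in
/-- The cocycles of `Hom(B, T)`. -/
abbrev homCocycles (B : ModuleCat.{u} R) (n : ℕ) : ModuleCat.{u} R :=
  ModuleCat.of R (LinearMap.ker ((homSeq B T).d n))

variable (T) in
/-- The cocycles of `Hom(B, T)` are the homomorphisms to the cocycles of `T`. -/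
def homCocyclesEquiv (B : ModuleCat.{u} R) (n : ℕ) :
    (B →ₗ[R] LinearMap.ker (T.d n)) ≃ₗ[R] LinearMap.ker ((homSeq B T).d n) where
  toFun f := ⟨(LinearMap.ker (T.d n)).subtype ∘ₗ f, LinearMap.ext fun b => (f b).2⟩
  map_add' _ _ := rfl
  map_smul' _ _ := rfl
  invFun f := LinearMap.codRestrict _ (f.1 : B →ₗ[R] T.X n) fun b => LinearMap.congr_fun f.2 b
  left_inv _ := rfl
  right_inv _ := rfl

variable [IsLocalRing R]

/-- Positive width means Z = mZ; the cohomology, a quotient of Z, inherits this, and derived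
Nakayama kills it. -/
lemma HomVanishes.of_widthGE_homCocycles {l : List R}
    (hl : Ideal.span {x | x ∈ l} = maximalIdeal R) {B : ModuleCat.{u} R} {n : ℕ}
    (hdc : ∀ x ∈ l, DerivedComplete ((homSeq B T).H n) x)
    (h : WidthGE 1 (T.homCocycles B (n + 1))) : T.HomVanishes n B := by
  refine subsingleton_of_derivedComplete l hdc ?_
  have h1 := congrArg (Submodule.map (toH (C := homSeq B T) (n := n))) h.smul_top_eq_top
  rwa [Submodule.map_smul'', Submodule.map_top, LinearMap.range_eq_top.2 toH_surjective, ← hl] at h1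

/-- Vanishing cohomology makes the differential surjective onto the next cocycles, so the long exact
sequence of Tor costs one unit of width. -/
lemma WidthGE.homCocycles {B : ModuleCat.{u} R} {n c : ℕ} (hB : T.HomVanishes n B)
    (h : WidthGE (c + 1) (T.homCocycles B (n + 1)))
    (hX : WidthGE c ((homSeq B T).X n)) : WidthGE c (T.homCocycles B n) := by
  refine WidthGE.of_shortExact_left (a := (LinearMap.ker ((homSeq B T).d n)).subtype)
    (b := LinearMap.codRestrict (LinearMap.ker ((homSeq B T).d (n + 1))) ((homSeq B T).d n)
      ((homSeq B T).d_d n)) (Submodule.subtype_injective _) ?_ ?_ h hX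
  · rintro ⟨f, hf⟩
    obtain ⟨g, hg⟩ := subsingleton_H_iff.1 hB f hf
    exact ⟨g, Subtype.ext hg⟩
  · intro f
    constructor
    · intro hf
      exact ⟨⟨f, congrArg Subtype.val hf⟩, rfl⟩
    · rintro ⟨f, rfl⟩
      exact Subtype.ext f.2

variable [IsNoetherianRing R]

theorem le_of_widthGE [Subsingleton (T.X 0)] (hT : ∀ n, Module.Injective R (T.X n)) {l : List R}
    (hl : Ideal.span {x | x ∈ l} = maximalIdeal R) {e s d : ℕ}
    (hzero : ∀ n < e, Subsingleton (T.H n)) (hdc : ∀ x ∈ l, ∀ n, DerivedComplete (T.H n) x)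
    (hgi : ∀ n > e + s, IsGorensteinInjective (ModuleCat.of R (LinearMap.ker (T.d n))))
    (hne : ∃ n, ¬ Subsingleton (T.H n)) {B : ModuleCat.{u} R} (hB : moduleWidth B < ⊤)
    (hw : ∀ N : ModuleCat.{u} R, IsGorensteinInjective N →
      WidthGE d (ModuleCat.of R (B →ₗ[R] N))) : d ≤ s := by
  by_contra hds
  push Not at hds
  have hdc' : ∀ x ∈ l, ∀ (A : ModuleCat.{u} R) (n : ℕ), DerivedComplete ((homSeq A T).H n) x :=
    fun x hx A n => derivedComplete_homSeq_H hT (hdc x hx) A n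
  have hbig : ∀ n > e + s, WidthGE d (T.homCocycles B n) := fun n hn =>
    (hw _ (hgi n hn)).of_equiv (T.homCocyclesEquiv B n)
  have hX : ∀ n, WidthGE d ((homSeq B T).X n) := fun n =>
    hw _ (isGorensteinInjective_of_injective (hT n))
  have hvan : ∀ n, WidthGE 1 (T.homCocycles B (n + 1)) → T.HomVanishes n B := fun n =>
    HomVanishes.of_widthGE_homCocycles hl fun x hx => hdc' x hx B n
  -- Descent from index e + s + 1 to e + 1 takes s steps, so width at least d - s > 0 remains at the
  -- end.
  have hmid : ∀ k ≤ s, ∀ n, n + k = e + s → WidthGE (d - k) (T.homCocycles B (n + 1)) := by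
    intro k
    induction k with
    | zero =>
      intro _ n hn
      exact hbig (n + 1) (by omega)
    | succ k ih =>
      intro hk n hn
      have h1 := ih (by omega) (n + 1) (by omega)
      refine WidthGE.homCocycles (hvan _ (h1.mono (by omega))) ?_ ((hX _).mono (Nat.sub_le _ _))
      rwa [show d - (k + 1) + 1 = d - k by omega]
  have hall : ∀ n, T.HomVanishes n B := by
    intro n
    rcases lt_or_ge n e with h | h
    -- Below index e, T is exact and starts with zero, so Hom(B, -) preserves exactness.
    · refine subsingleton_homSeq_H hT ?_ n (fun m hm => hzero m (by omega)) B
      exact fun _ _ _ => Subsingleton.elim _ _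
    · rcases le_or_gt n (e + s) with h' | h'
      · exact hvan n ((hmid (e + s - n) (by omega) n (by omega)).mono (by omega))
      · exact hvan n ((hbig (n + 1) (by omega)).mono (by omega))
  obtain ⟨n, hn⟩ := hne
  refine hn (subsingleton_H_of_homVanishes ?_)
  exact homVanishes_of_residueField hT l ∅ (by rw [Set.empty_union, hl]) hdc'
    (homVanishes_residueField hT hall hB) (ModuleCat.of R R) (inferInstanceAs (Module.Finite R R))
    (by simp) n

/-- The main inequality for sequences. -/
theorem le_of_finite_H {C : CochainSeq R} {l : List R}
    (hl : Ideal.span {x | x ∈ l} = maximalIdeal R) {s d : ℕ}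
    (hC : ∀ n, IsGorensteinInjective (C.X n)) (hfin : ∀ n, Module.Finite R (C.H n))
    (hlow : ∀ n ≤ l.length, Subsingleton (C.X n))
    (hhigh : ∀ n ≥ l.length + s + 2, Subsingleton (C.X n))
    (hne : ∃ n, ¬ Subsingleton (C.H n)) {B : ModuleCat.{u} R} (hB : moduleWidth B < ⊤)
    (hw : ∀ N : ModuleCat.{u} R, IsGorensteinInjective N →
      WidthGE d (ModuleCat.of R (B →ₗ[R] N))) : d ≤ s := by
  have h0 : Subsingleton ((C.completeList l).X 0) :=
    subsingleton_completeList_of_le l (k := 0) (fun n hn => hlow n (by omega)) 0 le_rfl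
  have hD := isGorensteinInjective_completeList hC l
  have hE : ∀ n, Nonempty (((C.completeList l).resolution hD).H n ≃ₗ[R]
      completion (ModuleCat.of R (C.H n)) l) := fun n => by
    obtain ⟨e⟩ := nonempty_resolution_H_equiv (C.completeList l) hD n
    obtain ⟨e'⟩ := nonempty_completeList_H_equiv C hfin l n
    exact ⟨e.trans e'⟩
  refine le_of_widthGE (T := (C.completeList l).resolution hD) (l := l) (e := l.length)
    (injective_resolution _ hD) hl ?_ ?_ ?_ ?_ hB hw
  · intro n hn
    obtain ⟨e⟩ := hE n
    have h1 : Subsingleton (C.X (n + 1)) := hlow (n + 1) hn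
    have h2 : Subsingleton (completion (ModuleCat.of R (C.H n)) l) := by
      refine subsingleton_of_forall_eq 0 fun a => ?_
      -- A zero module is killed by 1, and so is its completion.
      rw [← one_smul R a]
      refine completion_smul_eq_zero (fun c => ?_) l a
      have h3 : Subsingleton (C.H n) :=
        subsingleton_H_iff.2 fun x _ => ⟨0, Subsingleton.elim _ _⟩
      exact Subsingleton.elim (α := C.H n) _ _
    exact e.toEquiv.subsingleton
  · intro x hx n
    obtain ⟨e⟩ := hE n
    exact (derivedComplete_completion _ l hx).of_equiv e.symm
  · intro n hn
    have : Subsingleton ((C.completeList l).X (n + 1)) :=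
      subsingleton_completeList_of_ge l hhigh (n + 1) (by omega)
    exact isGorensteinInjective_ker_resolution _ hD n
  · obtain ⟨n, hn⟩ := hne
    obtain ⟨e⟩ := hE n
    refine ⟨n, fun hs => hn ?_⟩
    have h1 := e.symm.toEquiv.subsingleton
    have hM : Module.Finite R (C.H n) := hfin n
    -- The completion maps onto H/mH; if it vanished, Nakayama's lemma would give H = 0.
    let N : Submodule R (C.H n) := maximalIdeal R • ⊤
    obtain ⟨q, hq⟩ := exists_surjective_completion (M := ModuleCat.of R (C.H n))
      (N := ModuleCat.of R (C.H n ⧸ N)) (q := N.mkQ) N.mkQ_surjective l fun x hx c => by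
        obtain ⟨c, rfl⟩ := N.mkQ_surjective c
        refine (Submodule.Quotient.mk_eq_zero N (x := x • c)).2 (Submodule.smul_mem_smul ?_ trivial)
        rw [← hl]
        exact Ideal.subset_span hx
    have h2 : Subsingleton (C.H n ⧸ N) := hq.subsingleton
    rw [Submodule.Quotient.subsingleton_iff] at h2
    rw [← Submodule.subsingleton_iff R]
    refine subsingleton_of_bot_eq_top (Submodule.eq_bot_of_le_smul_of_le_jacobson_bot
      (maximalIdeal R) ⊤ hM.fg_top h2.symm.le ?_).symm
    exact (IsLocalRing.jacobson_eq_maximalIdeal ⊥ bot_ne_top).symm.le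

end CochainSeq

/-! ### Passage from chain complexes to cochain sequences -/

section Main

variable {R : Type u} [CommRing R]

/-- The sequence obtained from a chain complex by reversing the numbering. -/
def CochainSeq.ofChainComplex (I : ChainComplex (ModuleCat.{u} R) ℤ) (e : ℤ) : CochainSeq R where
  X n := I.X (e - n)
  d n := (I.d (e - n) (e - (n + 1 : ℕ))).hom
  d_d n x := by
    rw [← LinearMap.comp_apply, ← ModuleCat.hom_comp, I.d_comp_d]
    rfl

lemma CochainSeq.nonempty_ofChainComplex_H_equiv (I : ChainComplex (ModuleCat.{u} R) ℤ) (e : ℤ)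
    (n : ℕ) :
    Nonempty ((CochainSeq.ofChainComplex I e).H n ≃ₗ[R] I.homology (e - (n + 1 : ℕ))) := by
  let S := I.sc' (e - n) (e - (n + 1 : ℕ)) (e - (n + 2 : ℕ))
  let i₁ : I.homology (e - (n + 1 : ℕ)) ≅ S.homology :=
    I.homologyIsoSc' _ _ _ (by simp; ring) (by simp; ring)
  have h : (LinearMap.range S.f.hom).submoduleOf (LinearMap.ker S.g.hom) =
      LinearMap.range S.moduleCatToCycles := by
    ext x
    exact exists_congr fun y => ⟨fun hy => Subtype.ext hy, congrArg Subtype.val⟩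
  let i₂ : (CochainSeq.ofChainComplex I e).H n ≃ₗ[R]
      (LinearMap.ker S.g.hom ⧸ LinearMap.range S.moduleCatToCycles) := Submodule.quotEquivOfEq _ _ h
  exact ⟨i₂.trans (i₁ ≪≫ S.moduleCatHomologyIso).symm.toLinearEquiv⟩

lemma WithBot.le_natCast_of_forall {x : WithBot ℕ∞} {s : ℕ}
    (h : ∀ d : ℕ, (d : WithBot ℕ∞) ≤ x → d ≤ s) : x ≤ s := by
  induction x using WithBot.recBotCoe with
  | bot => exact bot_le
  | coe x =>
    refine WithBot.coe_le_coe.2 (ENat.forall_natCast_le_iff_le.1 fun d hd => ?_)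
    exact Nat.cast_le.2 (h d (WithBot.coe_le_coe.2 hd))

end Main

theorem theorem3p4 {R : Type u} [CommRing R] [IsLocalRing R] [IsNoetherianRing R]
    (s : ℕ) (I : ChainComplex (ModuleCat.{u} R) ℤ)
    (hI_bounded : ∀ i : ℤ, i < -(s : ℤ) ∨ 0 < i → IsZero (I.X i))
    (hI_gorInj : ∀ i : ℤ, -(s : ℤ) ≤ i → i ≤ 0 → IsGorensteinInjective (I.X i))
    (hI_nonexact : ¬ I.Acyclic)
    (hI_homology : ∀ i : ℤ, Module.Finite R (I.homology i))
    (h : (∃ B : ModuleCat.{u} R, moduleWidth B < ⊤ ∧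
            ∀ N : ModuleCat.{u} R, IsGorensteinInjective N →
              ringKrullDim R ≤ ((moduleWidth (ModuleCat.of R (B →ₗ[R] N)) : ℕ∞) : WithBot ℕ∞)) ∨
          IsCohenMacaulayLocalRing R) :
    ringKrullDim R ≤ (s : WithBot ℕ∞) := by
  obtain ⟨B, hB, hw⟩ : ∃ B : ModuleCat.{u} R, moduleWidth B < ⊤ ∧
      ∀ N : ModuleCat.{u} R, IsGorensteinInjective N →
        ringKrullDim R ≤ ((moduleWidth (ModuleCat.of R (B →ₗ[R] N)) : ℕ∞) : WithBot ℕ∞) :=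
    h.elim id IsCohenMacaulayLocalRing.exists_width
  refine WithBot.le_natCast_of_forall fun d hd => ?_
  obtain ⟨t, ht⟩ := IsNoetherian.noetherian (IsLocalRing.maximalIdeal R)
  have hl : Ideal.span {x | x ∈ t.toList} = IsLocalRing.maximalIdeal R := by
    rw [← ht]
    simp [Ideal.span]
  let e := t.toList.length
  -- Degree 0 of I goes to index e + 1: the e completions use up e of the leading zeros, and one
  -- must be left at index 0.
  let C := CochainSeq.ofChainComplex I (e + 1)
  have hsub : ∀ i : ℤ, i < -(s : ℤ) ∨ 0 < i → Subsingleton (I.X i) := fun i hi =>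
    ModuleCat.isZero_iff_subsingleton.1 (hI_bounded i hi)
  refine CochainSeq.le_of_finite_H (C := C) hl ?_ ?_ ?_ ?_ ?_ hB fun N hN =>
    (natCast_le_moduleWidth_iff d _).1 (WithBot.coe_le_coe.1 (hd.trans (hw N hN)))
  · intro n
    by_cases hn : (e + 1 - n : ℤ) < -(s : ℤ) ∨ 0 < (e + 1 - n : ℤ)
    · have := hsub _ hn
      exact isGorensteinInjective_of_subsingleton (I.X (e + 1 - n))
    · push Not at hn
      exact hI_gorInj _ hn.1 hn.2
  · intro n
    obtain ⟨φ⟩ := CochainSeq.nonempty_ofChainComplex_H_equiv I (e + 1) n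
    have := hI_homology (e + 1 - (n + 1 : ℕ))
    exact Module.Finite.equiv φ.symm
  · intro n hn
    exact hsub _ (Or.inr (by omega))
  · intro n hn
    exact hsub _ (Or.inl (by omega))
  · by_contra hc
    push Not at hc
    refine hI_nonexact fun i => ?_
    rw [HomologicalComplex.exactAt_iff_isZero_homology]
    by_cases hi : i < -(s : ℤ) ∨ 0 < i
    · rw [← HomologicalComplex.exactAt_iff_isZero_homology]
      exact ShortComplex.exact_of_isZero_X₂ _ (hI_bounded i hi)
    · push Not at hi
      obtain ⟨n, hn⟩ : ∃ n : ℕ, i = e + 1 - (n + 1 : ℕ) := ⟨(e - i).toNat, by omega⟩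
      obtain ⟨φ⟩ := CochainSeq.nonempty_ofChainComplex_H_equiv I (e + 1) n
      have := hc n
      rw [hn]
      exact ModuleCat.isZero_iff_subsingleton.2 φ.symm.toEquiv.subsingleton
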